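/- For a language $X$ over a finite alphabet $\Gamma$, let $\mathrm{Seq}(X)$ be the language over $\Gamma\cup\{\#\}$, where $\#\notin\Gamma$ is a new letter, consisting of all words $\# x_1\# x_2\#\dots\# x_n\#$ with $x_1,\dots,x_n\in\Gamma^*$ such that $x_i\in X$ for at least one $i$. For languages $X,Y$ over finite alphabets write $Y\le_{\mathrm m}^{\log}X$ if there is a function $f$, computed by a deterministic Turing machine with a read-only input tape, a write-only output tape and work tapes of size $O(\log n)$ on inputs of length $n$, such that $w\in Y\iff f(w)\in X$ for all words $w$. A class $\mathcal C$ of languages over finite alphabets is called normal if, for every $X\in\mathcal C$, we have $\mathrm{Seq}(X)\in\mathcal C$, and $Y\in\mathcal C$ for every $Y\le_{\mathrm m}^{\log}X$. Let $\Sigma^p_0=\mathrm P$ be the class of languages decidable by deterministic Turing machines in polynomial time. For $k\ge 0$, let $\Pi^p_k$ be the class of complements of languages in $\Sigma^p_k$, and let $\Sigma^p_{k+1}$ be the class of languages $L$ for which there are a language $V\in\Pi^p_k$ and a polynomial $p$ such that for all words $x$ $$x\in L\iff \exists y\in\{0,1\}^*\ \bigl(|y|\le p(|x|)\ \wedge\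 \langle x,y\rangle\in V\bigr).$$ Proposition. For every $k\ge 0$, the classes $\Sigma^p_k$ and $\Pi^p_k$ of the polynomial hierarchy are normal. -/

import Mathlib

/-! ### Multitape Turing machines with read-only input and write-only output -/

/-- What the input head sees: one of the two end markers, or a letter of the input word. -/
inductive InputCell (α : Type) where
  | leftEnd : InputCell α
  | letter : α → InputCell α
  | rightEnd : InputCell α

/-- Head moves. -/
inductive HeadMove where
  | left
  | stay
  | right

/-- What a machine does in one step: the next state, the move of the input head, the symbol
written and the head move on each work tape, and possibly one letter for the output tape. -/
structure TMAction (Q K Γ β : Type) where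
  next : Q
  inMove : HeadMove
  write : K → Γ
  move : K → HeadMove
  emit : Option β

/-- A deterministic Turing machine with a two-way read-only input tape over `α`, finitely many
two-way work tapes (indexed by `K`) over `Γ`, each infinite to the right only, and a write-only
one-way output tape over `β`. The machine halts when `δ` returns `none`. -/
structure TM (α β : Type) where
  Q : Type
  K : Type
  Γ : Type
  finQ : Finite Q
  finK : Finite K
  finΓ : Finite Γ
  start : Q
  blank : Γ
  δ : Q → InputCell α → (K → Γ) → Option (TMAction Q K Γ β)

/-- The cell at position `p` of the input tape holding `x`: the markers are at the positions
`0` and `|x| + 1`, the letters of `x` at the positions `1, …, |x|`. -/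
def inputCellAt {α : Type} (x : List α) : ℕ → InputCell α
  | 0 => InputCell.leftEnd
  | p + 1 =>
    match x[p]? with
    | some a => InputCell.letter a
    | none => InputCell.rightEnd

/-- Movement of the input head, which never leaves the positions `0, …, n + 1`. -/
def HeadMove.applyInput (n : ℕ) : HeadMove → ℕ → ℕ
  | HeadMove.left, p => p - 1
  | HeadMove.stay, p => p
  | HeadMove.right, p => min (p + 1) (n + 1)

/-- Movement of the head of a work tape (a left move in the leftmost cell has no effect). -/
def HeadMove.applyWork : HeadMove → ℕ → ℕ
  | HeadMove.left, p => p - 1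
  | HeadMove.stay, p => p
  | HeadMove.right, p => p + 1

namespace TM

variable {α β : Type}

/-- A configuration; `out` is what has been written on the output tape so far. -/
structure Cfg (M : TM α β) where
  state : M.Q
  inPos : ℕ
  tape : M.K → ℕ → M.Γ
  head : M.K → ℕ
  out : List β

/-- The initial configuration. -/
def initCfg (M : TM α β) : M.Cfg where
  state := M.start
  inPos := 0
  tape := fun _ _ => M.blank
  head := fun _ => 0
  out := []

/-- One step on input `x`; `none` if the machine has halted. -/
def step (M : TM α β) (x : List α) (c : M.Cfg) : Option M.Cfg :=
  (M.δ c.state (inputCellAt x c.inPos) (fun k => c.tape k (c.head k))).map fun a =>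
    { state := a.next
      inPos := a.inMove.applyInput x.length c.inPos
      tape := fun k => Function.update (c.tape k) (c.head k) (a.write k)
      head := fun k => (a.move k).applyWork (c.head k)
      out := c.out ++ a.emit.toList }

/-- The configuration after exactly `t` steps on input `x`, if the machine makes that many. -/
def cfgAt (M : TM α β) (x : List α) : ℕ → Option M.Cfg
  | 0 => some M.initCfg
  | t + 1 => (M.cfgAt x t).bind (M.step x)

/-- On input `x`, the machine halts after exactly `t` steps with output `y`. -/
def HaltsWith (M : TM α β) (x : List α) (t : ℕ) (y : List β) : Prop :=
  ∃ c : M.Cfg, M.cfgAt x t = some c ∧ M.step x c = none ∧ c.out = y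

/-- On input `x`, the machine uses at most the first `s` cells of each of its work tapes. -/
def UsesSpace (M : TM α β) (x : List α) (s : ℕ) : Prop :=
  ∀ (t : ℕ) (c : M.Cfg), M.cfgAt x t = some c → ∀ k, c.head k < s

end TM

/-- Functions computable in polynomial time. -/
def PolyTimeComputable {α β : Type} (f : List α → List β) : Prop :=
  ∃ (M : TM α β) (p : Polynomial ℕ),
    ∀ x : List α, ∃ t ≤ p.eval x.length, M.HaltsWith x t (f x)

/-- Functions computable in space `O(log n)` on the work tapes. -/
def LogSpaceComputable {α β : Type} (f : List α → List β) : Prop :=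
  ∃ (M : TM α β) (c : ℕ),
    ∀ x : List α, (∃ t, M.HaltsWith x t (f x)) ∧
      M.UsesSpace x (c * (Nat.log 2 x.length + 1))

/-- `A` is reducible to `B` by a log-space many-one reduction. -/
def LogSpaceReducible {α β : Type} (A : Language α) (B : Language β) : Prop :=
  ∃ f : List α → List β, LogSpaceComputable f ∧ ∀ x, x ∈ A ↔ f x ∈ B

/-! ### Classes of languages and the polynomial hierarchy -/

/-- A class of languages over finite alphabets. -/
abbrev LanguageClass : Type 1 := ∀ (α : Type) [Finite α], Language α → Prop

open Classical in
/-- The class P: languages whose characteristic function is computable in polynomial time. -/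
noncomputable def ClassP : LanguageClass := fun _ _ L =>
  PolyTimeComputable (fun x => [decide (x ∈ L)])

/-- The word over `α ⊕ Bool` that codes the pair of a word over `α` and a binary word. -/
def pairWord {α : Type} (x : List α) (y : List Bool) : List (α ⊕ Bool) :=
  x.map Sum.inl ++ y.map Sum.inr

/-- The classes `Σₖᵖ`: `Σ₀ᵖ` is P, and `L` is in `Σₖ₊₁ᵖ` if for some `V` in `Πₖᵖ` (that is, with
complement in `Σₖᵖ`) and some polynomial `p`, `x ∈ L ↔ ∃ y, |y| ≤ p(|x|) ∧ ⟨x, y⟩ ∈ V`. -/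
noncomputable def SigmaP : ℕ → LanguageClass
  | 0 => ClassP
  | k + 1 => fun α _ L =>
    ∃ (V : Language (α ⊕ Bool)) (p : Polynomial ℕ), SigmaP k (α ⊕ Bool) Vᶜ ∧
      ∀ x : List α, x ∈ L ↔ ∃ y : List Bool, y.length ≤ p.eval x.length ∧ pairWord x y ∈ V

/-- The classes `Πₖᵖ`: complements of the languages in `Σₖᵖ`. -/
noncomputable def PiP (k : ℕ) : LanguageClass := fun α _ L => SigmaP k α Lᶜ

/-! ### Delimited lists and normal classes -/

/-- The word `# x₁ # x₂ # ⋯ # xₙ #`; the delimiter `#` is the new letter `none`. -/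
def listWord {α : Type} (l : List (List α)) : List (Option α) :=
  none :: l.flatMap (fun x => x.map some ++ [none])

/-- `Seq(X)`: the words `# x₁ # x₂ # ⋯ # xₙ #` with `xᵢ ∈ X` for some `i`. -/
def SeqLang {α : Type} (X : Language α) : Language (Option α) :=
  {w | ∃ l : List (List α), w = listWord l ∧ ∃ x ∈ l, x ∈ X}

/-- A class of languages is normal if it is closed under `X ↦ Seq(X)` and under log-space
many-one reductions. -/
def IsNormalClass (C : LanguageClass) : Prop :=
  (∀ (α : Type) [Finite α] (X : Language α), C α X → C (Option α) (SeqLang X)) ∧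
  (∀ (α β : Type) [Finite α] [Finite β] (X : Language α) (Y : Language β),
    C α X → LogSpaceReducible Y X → C β Y)

/-! ### Runs of partial step functions -/

/-! Two closure properties suffice: each Σₖ is closed under preimages along polynomial-time
functions (`SigmaP.preimage`), and Seq preserves both Σₖ and Πₖ (`SigmaP.seqLang`). Log-space
reductions are covered by the first, because a halting deterministic machine never repeats a
configuration and only polynomially many configurations fit into logarithmic space
(`LogSpaceComputable.polyTimeComputable`). A reduction also reduces the complements, which settles
Πₖ.

Seq is treated by induction on k, for Σ and Π together. Suppose that x ∈ X means ⟨x, y⟩ ∈ V for some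
short y, with V in Πₖ. Then #x₁#…#xₙ# is in Seq(X) iff for some short y₁, …, yₙ the list of the
pairs ⟨xᵢ, yᵢ⟩ is in Seq(V), which is again in Πₖ. Dually, if V certifies membership in Xᶜ, then all
xᵢ avoid X iff for some short y₁, …, yₙ the list of pairs is not in Seq(Vᶜ), and Seq(Vᶜ) is in Σₖ.
The yᵢ are guessed at once, concatenated in a self-delimiting code; `zipBlocks (truncPair p)` hands
them out and cuts each to its admissible length, so that overlong guesses do no harm. For k = 0 the
characteristic function is evaluated on every block.

It remains to see that these word functions run in polynomial time on the given machines. Machines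
are programmed with stacks; `toTM` and `SimCode` translate in both directions with a factor of two
in time. This yields closure under composition, concatenation and folds with polynomially bounded
state (`comp`, `append`, `foldl`); finite transducers supply the basic functions. -/

/-- `c'` is reached from `c` in exactly `t` steps. -/
inductive StepsTo {C : Type} (step : C → Option C) : ℕ → C → C → Prop where
  | refl (c : C) : StepsTo step 0 c c
  | head {n : ℕ} {a b c : C} : step a = some b → StepsTo step n b c → StepsTo step (n + 1) a c

namespace StepsTo

variable {C : Type} {step : C → Option C}

theorem trans {m n : ℕ} {a b c : C} (h : StepsTo step m a b) (h' : StepsTo step n b c) :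
    StepsTo step (m + n) a c := by
  induction h with
  | refl => simpa using h'
  | head h₁ _ ih =>
    rw [Nat.add_right_comm]
    exact .head h₁ (ih h')

theorem single {a b : C} (h : step a = some b) : StepsTo step 1 a b := .head h (.refl b)

theorem tail {n : ℕ} {a b c : C} (h : StepsTo step n a b) (h' : step b = some c) :
    StepsTo step (n + 1) a c := h.trans (single h')

/-- A step-by-step simulation, `m` steps for one. -/
theorem simulate {D : Type} {step' : D → Option D} (R : C → D → Prop) (m : ℕ)
    (hR : ∀ a b d, step a = some b → R a d → ∃ e, StepsTo step' m d e ∧ R b e)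
    {n : ℕ} {a b : C} (h : StepsTo step n a b) {d : D} (hd : R a d) :
    ∃ e, StepsTo step' (m * n) d e ∧ R b e := by
  induction h generalizing d with
  | refl c => exact ⟨d, .refl d, hd⟩
  | head h₁ _ ih =>
    obtain ⟨e, he, hRe⟩ := hR _ _ _ h₁ hd
    obtain ⟨e', he', hRe'⟩ := ih hRe
    refine ⟨e', ?_, hRe'⟩
    rw [Nat.mul_succ, Nat.add_comm]
    exact he.trans he'

theorem invariant (I : C → Prop) (hI : ∀ a b, step a = some b → I a → I b)
    {n : ℕ} {a b : C} (h : StepsTo step n a b) (ha : I a) : I b := by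
  induction h with
  | refl => exact ha
  | head h₁ _ ih => exact ih (hI _ _ h₁ ha)

end StepsTo

/-! ### Stack machines -/

/-- An operation on a stack: possibly remove the top symbol, then possibly push a symbol. -/
structure StackOp (S : Type) where
  pop : Bool
  push : Option S

namespace StackOp

variable {S : Type}

def nop : StackOp S := ⟨false, none⟩

def apply (o : StackOp S) (l : List S) : List S :=
  o.push.toList ++ if o.pop then l.tail else l

@[simp] theorem nop_apply (l : List S) : nop.apply l = l := rfl

@[simp] theorem mk_apply (p : Bool) (q : Option S) (l : List S) :
    (⟨p, q⟩ : StackOp S).apply l = q.toList ++ if p then l.tail else l := rfl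

theorem length_apply_le (o : StackOp S) (l : List S) : (o.apply l).length ≤ l.length + 1 := by
  rcases o with ⟨_ | _, _ | s⟩ <;> (simp [apply]; try omega)

end StackOp

/-- What a stack machine does in one step. -/
structure StackAction (Q V S β : Type) where
  next : Q
  inMove : HeadMove
  op : V → StackOp S
  emit : Option β

/-- The data of a stack machine: the position on the input tape, the stacks and the output. -/
structure Store (V S β : Type) where
  pos : ℕ
  stack : V → List S
  out : List β

/-- A machine with a read-only input tape over `α`, stacks indexed by `V` over `S`, and output
over `β`. It halts when `δ` returns `none`. -/
structure StackMachine (V S α β : Type) where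
  Q : Type
  finQ : Finite Q
  start : Q
  δ : Q → InputCell α → (V → Option S) → Option (StackAction Q V S β)

namespace Store

variable {V S β : Type}

/-- The top symbols of the stacks. -/
def tops (s : Store V S β) (v : V) : Option S := (s.stack v).head?

/-- The store with new stacks. -/
def withStack (s : Store V S β) (σ : V → List S) : Store V S β := ⟨s.pos, σ, s.out⟩

@[simp] theorem stack_withStack (s : Store V S β) (σ : V → List S) :
    (s.withStack σ).stack = σ := rfl

@[simp] theorem withStack_withStack (s : Store V S β) (σ σ' : V → List S) :
    (s.withStack σ).withStack σ' = s.withStack σ' := rfl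

end Store

namespace StackMachine

variable {V S α β : Type}

/-- The effect of an action on the store, for an input of length `n`. -/
def _root_.StackAction.apply {Q : Type} (n : ℕ) (a : StackAction Q V S β) (s : Store V S β) :
    Store V S β :=
  ⟨a.inMove.applyInput n s.pos, fun v => (a.op v).apply (s.stack v), s.out ++ a.emit.toList⟩

def step (P : StackMachine V S α β) (x : List α) (c : P.Q × Store V S β) :
    Option (P.Q × Store V S β) :=
  (P.δ c.1 (inputCellAt x c.2.pos) c.2.tops).map fun a => (a.next, a.apply x.length c.2)

/-- On input `x` and store `s`, the machine halts after at most `b` steps with store `s'`. -/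
def RunsIn (P : StackMachine V S α β) (x : List α) (s : Store V S β) (b : ℕ)
    (s' : Store V S β) : Prop :=
  ∃ t ≤ b, ∃ q, StepsTo (P.step x) t (P.start, s) (q, s') ∧ P.step x (q, s') = none

theorem RunsIn.mono {P : StackMachine V S α β} {x : List α} {s s' : Store V S β} {b b' : ℕ}
    (h : P.RunsIn x s b s') (hb : b ≤ b') : P.RunsIn x s b' s' := by
  obtain ⟨t, ht, h⟩ := h
  exact ⟨t, ht.trans hb, h⟩

theorem RunsIn.cast {P : StackMachine V S α β} {x : List α} {s s' s'' : Store V S β} {b b' : ℕ}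
    (h : P.RunsIn x s b s') (hb : b ≤ b') (hs : s' = s'') : P.RunsIn x s b' s'' :=
  hs ▸ h.mono hb

/-- In `b` steps a stack grows by at most `b` symbols. -/
theorem RunsIn.length_le {P : StackMachine V S α β} {x : List α} {s s' : Store V S β} {b : ℕ}
    (h : P.RunsIn x s b s') (v : V) : (s'.stack v).length ≤ (s.stack v).length + b := by
  obtain ⟨t, ht, q, h, -⟩ := h
  refine le_trans ?_ (Nat.add_le_add_left ht _)
  have key : ∀ {n : ℕ} {a b : P.Q × Store V S β}, StepsTo (P.step x) n a b →
      (b.2.stack v).length ≤ (a.2.stack v).length + n := by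
    intro n a b h
    induction h with
    | refl => simp
    | @head n a b c h₁ _ ih =>
      simp only [step, Option.map_eq_some_iff] at h₁
      obtain ⟨act, -, rfl⟩ := h₁
      have := (act.op v).length_apply_le (a.2.stack v)
      simp only [StackAction.apply] at ih
      omega
  exact key h

/-! #### Programs -/

/-- One step, which depends on the input cell and on the top symbols. -/
def prim (move : InputCell α → (V → Option S) → HeadMove)
    (op : InputCell α → (V → Option S) → V → StackOp S)
    (emit : InputCell α → (V → Option S) → Option β) : StackMachine V S α β where
  Q := Bool
  finQ := inferInstance
  start := false
  δ := fun q i t => if q then none else some ⟨true, move i t, op i t, emit i t⟩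

theorem prim_runsIn (move : InputCell α → (V → Option S) → HeadMove)
    (op : InputCell α → (V → Option S) → V → StackOp S)
    (emit : InputCell α → (V → Option S) → Option β) (x : List α) (s : Store V S β) :
    (prim move op emit).RunsIn x s 1
      ⟨(move (inputCellAt x s.pos) s.tops).applyInput x.length s.pos,
        fun v => (op (inputCellAt x s.pos) s.tops v).apply (s.stack v),
        s.out ++ (emit (inputCellAt x s.pos) s.tops).toList⟩ :=
  ⟨1, le_rfl, true, StepsTo.single rfl, rfl⟩

/-- One step that changes only the stacks. -/
def stackPrim (op : (V → Option S) → V → StackOp S) : StackMachine V S α β :=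
  prim (fun _ _ => .stay) (fun _ => op) (fun _ _ => none)

theorem stackPrim_runsIn (op : (V → Option S) → V → StackOp S) (x : List α) (s : Store V S β) :
    (stackPrim op).RunsIn x s 1 (s.withStack fun v => (op s.tops v).apply (s.stack v)) := by
  refine (prim_runsIn (fun _ _ => .stay) (fun _ => op) (fun _ _ => none) x s).cast le_rfl ?_
  simp [HeadMove.applyInput, Store.withStack]

/-- `P₁`, then `P₂`. -/
def seq (P₁ P₂ : StackMachine V S α β) : StackMachine V S α β where
  Q := P₁.Q ⊕ P₂.Q
  finQ := by
    have := P₁.finQ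
    have := P₂.finQ
    infer_instance
  start := .inl P₁.start
  δ := fun q i t =>
    match q with
    | .inl q =>
      some <| match P₁.δ q i t with
        | some a => ⟨.inl a.next, a.inMove, a.op, a.emit⟩
        | none => ⟨.inr P₂.start, .stay, fun _ => .nop, none⟩
    | .inr q => (P₂.δ q i t).map fun a => ⟨.inr a.next, a.inMove, a.op, a.emit⟩

/-- The additional step is the idle transition from the halting configuration of `P₁` to the start
of `P₂`. -/
theorem seq_runsIn {P₁ P₂ : StackMachine V S α β} {x : List α} {s s₁ s₂ : Store V S β}
    {b₁ b₂ : ℕ} (h₁ : P₁.RunsIn x s b₁ s₁) (h₂ : P₂.RunsIn x s₁ b₂ s₂) :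
    (seq P₁ P₂).RunsIn x s (b₁ + b₂ + 1) s₂ := by
  obtain ⟨t₁, ht₁, q₁, h₁, e₁⟩ := h₁
  obtain ⟨t₂, ht₂, q₂, h₂, e₂⟩ := h₂
  obtain ⟨c, hc, rfl⟩ := h₁.simulate (step' := (seq P₁ P₂).step x)
    (fun a d => d = (Sum.inl a.1, a.2)) 1 (by
      rintro a b d hab rfl
      refine ⟨_, .single ?_, rfl⟩
      simp only [step, Option.map_eq_some_iff] at hab
      obtain ⟨act, hact, rfl⟩ := hab
      simp [step, seq, hact, StackAction.apply]) rfl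
  obtain ⟨c', hc', rfl⟩ := h₂.simulate (step' := (seq P₁ P₂).step x)
    (fun a d => d = (Sum.inr a.1, a.2)) 1 (by
      rintro a b d hab rfl
      refine ⟨_, .single ?_, rfl⟩
      simp only [step, Option.map_eq_some_iff] at hab
      obtain ⟨act, hact, rfl⟩ := hab
      simp [step, seq, hact, StackAction.apply]) rfl
  refine ⟨t₁ + (1 + t₂), by omega, .inr q₂, ?_, ?_⟩
  · rw [one_mul] at hc hc'
    refine hc.trans (StepsTo.trans (StepsTo.single ?_) hc')
    simp only [step, Option.map_eq_none_iff] at e₁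
    simp [step, seq, e₁, StackAction.apply, HeadMove.applyInput]
  · simp only [step, Option.map_eq_none_iff] at e₂
    simp [step, seq, e₂]

/-- Repeat `P` as long as the input cell and the top symbols satisfy `cond`. -/
noncomputable def loop (cond : InputCell α → (V → Option S) → Prop) (P : StackMachine V S α β) :
    StackMachine V S α β where
  Q := Option P.Q
  finQ := by
    have := P.finQ
    infer_instance
  start := none
  δ := fun q i t =>
    match q with
    | none =>
      open Classical in
      if cond i t then some ⟨some P.start, .stay, fun _ => .nop, none⟩ else none
    | some q =>
      some <| match P.δ q i t with
        | some a => ⟨some a.next, a.inMove, a.op, a.emit⟩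
        | none => ⟨none, .stay, fun _ => .nop, none⟩

variable {cond : InputCell α → (V → Option S) → Prop} {P : StackMachine V S α β} {x : List α}
  {s s₁ s₂ : Store V S β}

theorem loop_runsIn_zero (h : ¬ cond (inputCellAt x s.pos) s.tops) :
    (loop cond P).RunsIn x s 0 s :=
  ⟨0, le_rfl, none, .refl _, by simp [step, loop, h]⟩

/-- A round costs two idle steps besides those of `P`: one after the successful test, one to return
to it. -/
theorem loop_runsIn_succ {b₁ b₂ : ℕ} (h : cond (inputCellAt x s.pos) s.tops)
    (h₁ : P.RunsIn x s b₁ s₁) (h₂ : (loop cond P).RunsIn x s₁ b₂ s₂) :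
    (loop cond P).RunsIn x s (b₁ + 2 + b₂) s₂ := by
  obtain ⟨t₁, ht₁, q₁, h₁, e₁⟩ := h₁
  obtain ⟨t₂, ht₂, q₂, h₂, e₂⟩ := h₂
  obtain ⟨c, hc, rfl⟩ := h₁.simulate (step' := (loop cond P).step x)
    (fun a d => d = (some a.1, a.2)) 1 (by
      rintro a b d hab rfl
      refine ⟨_, .single ?_, rfl⟩
      simp only [step, Option.map_eq_some_iff] at hab
      obtain ⟨act, hact, rfl⟩ := hab
      simp [step, loop, hact, StackAction.apply]) rfl
  refine ⟨1 + (t₁ + (1 + t₂)), by omega, q₂, ?_, e₂⟩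
  rw [one_mul] at hc
  refine (StepsTo.single ?_).trans (hc.trans (StepsTo.trans (StepsTo.single ?_) h₂))
  · simp [step, loop, h, StackAction.apply, HeadMove.applyInput]
  · simp only [step, Option.map_eq_none_iff] at e₁
    simp [step, loop, e₁, StackAction.apply, HeadMove.applyInput]

/-- Move the symbols of the stack `u` one by one to all stacks in `D`. -/
noncomputable def pour [DecidableEq V] (u : V) (D : V → Prop) [DecidablePred D] : StackMachine V S α β :=
  loop (fun _ t => t u ≠ none) <| stackPrim fun t v =>
    if v = u then ⟨true, none⟩ else if D v then ⟨false, t u⟩ else .nop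

/-- Each symbol costs one step of the body and two of the loop. The order is reversed; pouring twice
restores it, and several targets give copies. -/
theorem pour_runsIn [DecidableEq V] (u : V) (D : V → Prop) [DecidablePred D] (x : List α) (s : Store V S β) :
    (pour u D).RunsIn x s (3 * (s.stack u).length) (s.withStack fun v =>
      if v = u then [] else if D v then (s.stack u).reverse ++ s.stack v else s.stack v) := by
  obtain ⟨l, hl⟩ : ∃ l, s.stack u = l := ⟨_, rfl⟩
  induction l generalizing s with
  | nil =>
    rw [hl]
    have : (s.withStack fun v => if v = u then [] else
        if D v then ([] : List S).reverse ++ s.stack v else s.stack v) = s := by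
      rcases s with ⟨p, σ, o⟩
      simp only [Store.withStack, Store.mk.injEq, true_and, and_true]
      funext v
      by_cases hv : v = u
      · subst hv; simpa using hl.symm
      · simp [hv]
    rw [this]
    exact loop_runsIn_zero (by simp [Store.tops, hl])
  | cons a l ih =>
    have h₁ := stackPrim_runsIn (β := β) (fun (t : V → Option S) v =>
      if v = u then (⟨true, none⟩ : StackOp S) else if D v then ⟨false, t u⟩ else .nop) x s
    have h₂ := ih _ (show (Store.stack (s.withStack fun v => StackOp.apply
      (if v = u then (⟨true, none⟩ : StackOp S) else if D v then ⟨false, s.tops u⟩ else .nop)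
        (s.stack v)) u) = l by simp [Store.withStack, hl])
    have h₃ := loop_runsIn_succ (cond := fun _ t => t u ≠ none) (by simp [Store.tops, hl]) h₁ h₂
    refine RunsIn.cast h₃ ?_ ?_
    · simp [Store.withStack, hl]; omega
    · simp only [Store.withStack, Store.mk.injEq, true_and, and_true]
      funext v
      by_cases hv : v = u
      · simp [hv]
      · by_cases hD : D v <;> simp [hv, hD, hl, Store.tops]

/-- Empty the stacks in `D`. -/
noncomputable def clear (D : V → Prop) [DecidablePred D] : StackMachine V S α β :=
  loop (fun _ t => ∃ v, D v ∧ t v ≠ none) <| stackPrim fun _ v =>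
    if D v then ⟨true, none⟩ else .nop

/-- All stacks in `D` are popped simultaneously, and popping an empty one is harmless, so only the
maximal height counts. -/
theorem clear_runsIn (D : V → Prop) [DecidablePred D] (x : List α) (s : Store V S β) (b : ℕ)
    (hb : ∀ v, D v → (s.stack v).length ≤ b) :
    (clear D).RunsIn x s (3 * b) (s.withStack fun v => if D v then [] else s.stack v) := by
  induction b generalizing s with
  | zero =>
    have h0 : ∀ v, D v → s.stack v = [] := fun v hv => by simpa using hb v hv
    have : (s.withStack fun v => if D v then [] else s.stack v) = s := by
      rcases s with ⟨p, σ, o⟩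
      simp only [Store.withStack, Store.mk.injEq, true_and, and_true]
      funext v
      by_cases hv : D v
      · simpa [hv] using (h0 v hv).symm
      · simp [hv]
    rw [this]
    refine loop_runsIn_zero ?_
    rintro ⟨v, hv, hne⟩
    exact hne (by simp [Store.tops, h0 v hv])
  | succ b ih =>
    by_cases hc : ∃ v, D v ∧ s.tops v ≠ none
    · have h₁ := stackPrim_runsIn (β := β) (fun (_ : V → Option S) v =>
        if D v then (⟨true, none⟩ : StackOp S) else .nop) x s
      have h₂ := ih (s.withStack fun v => StackOp.apply
        (if D v then (⟨true, none⟩ : StackOp S) else .nop) (s.stack v)) (by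
          intro v hv
          have := hb v hv
          simp [Store.withStack, hv]
          omega)
      have h₃ := loop_runsIn_succ (cond := fun _ t => ∃ v, D v ∧ t v ≠ none) hc h₁ h₂
      refine RunsIn.cast h₃ ?_ ?_
      · omega
      · simp only [Store.withStack, Store.mk.injEq, true_and, and_true]
        funext v
        by_cases hv : D v <;> simp [hv]
    · refine RunsIn.mono (b := 0) ?_ (Nat.zero_le _)
      have h0 : ∀ v, D v → s.stack v = [] := fun v hv => by
        by_contra hne
        exact hc ⟨v, hv, by simpa [Store.tops] using hne⟩
      have : (s.withStack fun v => if D v then [] else s.stack v) = s := by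
        rcases s with ⟨p, σ, o⟩
        simp only [Store.withStack, Store.mk.injEq, true_and, and_true]
        funext v
        by_cases hv : D v
        · simpa [hv] using (h0 v hv).symm
        · simp [hv]
      rw [this]
      exact loop_runsIn_zero hc

/-- Read the input backwards and push it, encoded by `e`, on the stack `u`. -/
noncomputable def loadInput [DecidableEq V] (u : V) (e : α → S) : StackMachine V S α β :=
    seq (loop (fun i _ => i ≠ .rightEnd) (prim (fun _ _ => .right) (fun _ _ _ => .nop)
    (fun _ _ => none)))
  (seq (prim (fun _ _ => .left) (fun _ _ _ => .nop) (fun _ _ => none))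
  (loop (fun i _ => i ≠ .leftEnd) (prim (fun _ _ => .left)
    (fun i _ v => if v = u then
      ⟨false, match i with | .letter a => some (e a) | _ => none⟩ else .nop)
    (fun _ _ => none))))

/-- Write the stack `u`, decoded by `d`, to the output, the top symbol first. -/
noncomputable def emitStack [DecidableEq V] (u : V) (d : S → Option β) : StackMachine V S α β :=
    loop (fun _ t => t u ≠ none) (prim (fun _ _ => .stay)
    (fun _ _ v => if v = u then ⟨true, none⟩ else .nop) (fun _ t => (t u).bind d))

theorem inputCellAt_succ (x : List α) (p : ℕ) (hp : p < x.length) :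
    inputCellAt x (p + 1) = .letter x[p] := by
  simp [inputCellAt, hp]

theorem inputCellAt_length_succ (x : List α) : inputCellAt x (x.length + 1) = .rightEnd := by
  simp [inputCellAt]

/-- The head first runs to the right end and pushes on the way back, which leaves the first letter
on top and the head at its initial position. The runs cost `3 * (n + 1)` and `3 * n` steps for `n`
letters, the turn one, the two compositions one each. -/
theorem loadInput_runsIn [DecidableEq V] (u : V) (e : α → S) (x : List α) (out : List β) :
    (loadInput u e).RunsIn x ⟨0, fun _ => [], out⟩ (6 * x.length + 6)
      ⟨0, fun v => if v = u then x.map e else [], out⟩ := by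
  have h₁ : ∀ d p (σ : V → List S), p + d = x.length + 1 →
      (loop (fun i _ => i ≠ .rightEnd) (prim (fun _ _ => .right) (fun _ _ _ => .nop)
        (fun _ _ => none))).RunsIn x ⟨p, σ, out⟩ (3 * d) ⟨x.length + 1, σ, out⟩ := by
    intro d
    induction d with
    | zero =>
      intro p σ hp
      obtain rfl : p = x.length + 1 := hp
      exact loop_runsIn_zero (by simp [inputCellAt_length_succ])
    | succ d ih =>
      intro p σ hp
      have hne : inputCellAt x p ≠ .rightEnd := by
        rcases p with _ | p
        · simp [inputCellAt]
        · rw [inputCellAt_succ x p (by omega)]; simp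
      have := prim_runsIn (fun _ _ => .right) (fun _ _ _ => StackOp.nop)
        (fun _ _ => none) x (⟨p, σ, out⟩ : Store V S β)
      simp only [HeadMove.applyInput, Option.toList_none, List.append_nil,
        StackOp.nop_apply] at this
      rw [min_eq_left (by omega)] at this
      have := loop_runsIn_succ (cond := fun i _ => i ≠ .rightEnd) hne this
        (ih (p + 1) σ (by omega))
      convert this using 1
      ring
  have h₂ := prim_runsIn (fun _ _ => .left) (fun _ _ _ => StackOp.nop)
    (fun _ _ => none) x (⟨x.length + 1, fun _ => [], out⟩ : Store V S β)
  simp only [HeadMove.applyInput, Option.toList_none, List.append_nil,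
        StackOp.nop_apply, Nat.add_sub_cancel] at h₂
  have h₃ : ∀ p (σ : V → List S), p ≤ x.length →
      (loop (fun i _ => i ≠ .leftEnd) (prim (fun _ _ => .left)
        (fun i _ v => if v = u then
          ⟨false, match i with | .letter a => some (e a) | _ => none⟩ else .nop)
        (fun _ _ => none))).RunsIn x ⟨p, σ, out⟩ (3 * p)
        ⟨0, fun v => if v = u then (x.take p).map e ++ σ v else σ v, out⟩ := by
    intro p
    induction p with
    | zero =>
      intro σ hp
      have := loop_runsIn_zero (P := (prim (fun _ _ => .left)
        (fun i _ v => if v = u then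
          ⟨false, match i with | .letter a => some (e a) | _ => none⟩ else .nop)
        (fun _ _ => none))) (x := x) (s := (⟨0, σ, out⟩ : Store V S β))
        (cond := fun i _ => i ≠ .leftEnd)
        (by simp [inputCellAt])
      simpa using this
    | succ p ih =>
      intro σ hp
      have hcell := inputCellAt_succ x p (by omega)
      have hp' := prim_runsIn (fun _ _ => .left)
        (fun i _ v => if v = u then
          ⟨false, match i with | .letter a => some (e a) | _ => none⟩ else .nop)
        (fun _ _ => none) x (⟨p + 1, σ, out⟩ : Store V S β)
      simp only [HeadMove.applyInput, Option.toList_none, List.append_nil,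
        hcell, Nat.add_sub_cancel] at hp'
      have := loop_runsIn_succ (cond := fun i _ => i ≠ .leftEnd) (by simp [hcell]) hp'
        (ih _ (by omega))
      refine RunsIn.cast this ?_ ?_
      · omega
      · simp only [Store.mk.injEq, true_and, and_true]
        funext v
        by_cases hv : v = u
        · rw [List.take_succ_eq_append_getElem (show p < x.length by omega), List.map_append]
          simp only [hv, if_true, StackOp.mk_apply, List.append_assoc]
          rfl
        · simp [hv]
  have := seq_runsIn (h₁ (x.length + 1) 0 (fun _ => []) (by omega))
    (seq_runsIn h₂ (h₃ x.length _ le_rfl))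
  simp only [List.take_length, List.append_nil] at this
  exact this.mono (by omega)

theorem emitStack_runsIn [DecidableEq V] (u : V) (d : S → Option β) (x : List α) (s : Store V S β) :
    (emitStack u d).RunsIn x s (3 * (s.stack u).length)
      ⟨s.pos, fun v => if v = u then [] else s.stack v,
        s.out ++ (s.stack u).filterMap d⟩ := by
  obtain ⟨l, hl⟩ : ∃ l, s.stack u = l := ⟨_, rfl⟩
  induction l generalizing s with
  | nil =>
    have : (⟨s.pos, fun v => if v = u then [] else s.stack v,
        s.out ++ (s.stack u).filterMap d⟩ : Store V S β) = s := by
      rcases s with ⟨p, σ, o⟩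
      simp only at hl
      simp only [hl, Store.mk.injEq, true_and, List.filterMap_nil, List.append_nil, and_true]
      funext v
      by_cases hv : v = u
      · subst hv; simpa using hl.symm
      · simp [hv]
    rw [this, hl]
    exact loop_runsIn_zero (by simp [Store.tops, hl])
  | cons a l ih =>
    have h₁ := prim_runsIn (fun _ _ => .stay)
      (fun _ _ v => if v = u then (⟨true, none⟩ : StackOp S) else .nop)
      (fun _ t => (t u).bind d) x s
    have h₂ := ih _ (show Store.stack (β := β) ⟨HeadMove.stay.applyInput x.length s.pos,
      fun v => (if v = u then (⟨true, none⟩ : StackOp S) else .nop).apply (s.stack v),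
      s.out ++ ((s.tops u).bind d).toList⟩ u = l by
        simp [hl])
    have h₃ := loop_runsIn_succ (cond := fun _ t => t u ≠ none) (by simp [Store.tops, hl]) h₁ h₂
    refine RunsIn.cast h₃ ?_ ?_
    · simp [hl]; omega
    · simp only [Store.mk.injEq]
      refine ⟨rfl, ?_, ?_⟩
      · funext v
        by_cases hv : v = u <;> simp [hv]
      · cases hd : d a <;> simp [hl, Store.tops, hd]

end StackMachine

/-! ### Turing machines simulate stack machines -/

namespace TM

variable {α β : Type}

theorem cfgAt_eq_some_of_stepsTo {M : TM α β} {x : List α} {t : ℕ} {c : M.Cfg}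
    (h : StepsTo (M.step x) t M.initCfg c) : M.cfgAt x t = some c := by
  suffices ∀ n c c', StepsTo (M.step x) n c c' → ∀ m, M.cfgAt x m = some c →
      M.cfgAt x (m + n) = some c' by simpa using this _ _ _ h 0 rfl
  intro n c c' h
  induction h with
  | refl => intro m hm; simpa using hm
  | @head n a b c h₁ _ ih =>
    intro m hm
    have := ih (m + 1) (by simp [cfgAt, hm, h₁])
    rwa [Nat.add_right_comm] at this

theorem stepsTo_of_cfgAt_eq_some {M : TM α β} {x : List α} {t : ℕ} {c : M.Cfg}
    (h : M.cfgAt x t = some c) : StepsTo (M.step x) t M.initCfg c := by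
  induction t generalizing c with
  | zero =>
    obtain rfl : M.initCfg = c := by simpa [cfgAt] using h
    exact .refl _
  | succ t ih =>
    simp only [cfgAt, Option.bind_eq_some_iff] at h
    obtain ⟨c', h', hc⟩ := h
    exact (ih h').tail hc

end TM

/-- The cells `0, …, |l|` of a tape hold the bottom marker `none` and then the stack `l`, its top
symbol in the cell `|l|`. -/
def HoldsStack {S : Type} (T : ℕ → Option S) : List S → Prop
  | [] => T 0 = none
  | a :: l => T (l.length + 1) = some a ∧ HoldsStack T l

namespace HoldsStack

variable {S : Type} {T : ℕ → Option S} {l : List S}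

theorem top (h : HoldsStack T l) : T l.length = l.head? := by
  cases l with
  | nil => exact h
  | cons a l => exact h.1

theorem tail (h : HoldsStack T l) : HoldsStack T l.tail := by
  cases l with
  | nil => exact h
  | cons a l => exact h.2

theorem update {i : ℕ} {y : Option S} (h : HoldsStack T l) (hi : l.length < i) :
    HoldsStack (Function.update T i y) l := by
  induction l with
  | nil =>
    have : 0 ≠ i := by simpa using hi.ne
    simpa [HoldsStack, Function.update_of_ne this] using h
  | cons a l ih =>
    simp only [List.length_cons] at hi
    refine ⟨?_, ih h.2 (by omega)⟩
    rw [Function.update_of_ne (by omega)]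
    exact h.1

theorem push (h : HoldsStack T l) (a : S) :
    HoldsStack (Function.update T (l.length + 1) (some a)) (a :: l) :=
  ⟨by simp, h.update (Nat.lt_succ_self _)⟩

end HoldsStack

/-- The head move on the tape of a stack with top symbol `t` that precedes the writing. -/
def StackOp.headMove {S : Type} (o : StackOp S) (t : Option S) : HeadMove :=
  match o.pop, o.push, t with
  | true, none, _ => .left
  | true, some _, none => .right
  | true, some _, some _ => .stay
  | false, none, _ => .stay
  | false, some _, _ => .right

/-- A left move at the bottom marker has no effect, just as popping an empty stack. Hence replacing
the top means staying in place on a nonempty stack, but moving right on an empty one. Popped symbols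
need not be erased, since nothing is required of the cells above the top. -/
theorem HoldsStack.apply {S : Type} {T : ℕ → Option S} {l : List S} (h : HoldsStack T l)
    (o : StackOp S) :
    (o.headMove l.head?).applyWork l.length = (o.apply l).length ∧
      HoldsStack (Function.update T (o.apply l).length
        (o.push.or (T (o.apply l).length))) (o.apply l) := by
  rcases o with ⟨_ | _, _ | a⟩
  · simpa [StackOp.headMove, HeadMove.applyWork] using h
  · simpa [StackOp.headMove, HeadMove.applyWork] using h.push a
  · cases l with
    | nil => simpa [StackOp.headMove, HeadMove.applyWork] using h
    | cons b l => simpa [StackOp.headMove, HeadMove.applyWork] using h.2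
  · cases l with
    | nil => simpa [StackOp.headMove, HeadMove.applyWork] using h.push a
    | cons b l => simpa [StackOp.headMove, HeadMove.applyWork] using h.2.push a

namespace StackMachine

variable {V S α β : Type}

/-- A Turing machine that simulates `P` with one work tape per stack and two steps for each
step of `P`: it first moves the heads and then writes. -/
def toTM [Finite V] [Finite S] (P : StackMachine V S α β) : TM α β where
  Q := P.Q × Option (V → Option S)
  K := V
  Γ := Option S
  finQ := by
    have := P.finQ
    infer_instance
  finK := inferInstance
  finΓ := inferInstance
  start := (P.start, none)
  blank := none
  δ := fun q i t =>
    match q with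
    | (q, none) => (P.δ q i t).map fun a =>
        ⟨(a.next, some fun v => (a.op v).push), a.inMove, t, fun v => (a.op v).headMove (t v),
          a.emit⟩
    | (q, some w) => some ⟨(q, none), .stay, fun v => (w v).or (t v), fun _ => .stay, none⟩

/-- A configuration of `P` and the corresponding configuration of `P.toTM`. -/
def TMRel [Finite V] [Finite S] (P : StackMachine V S α β) (c : P.Q × Store V S β)
    (d : P.toTM.Cfg) : Prop :=
  d.state = (c.1, none) ∧ d.inPos = c.2.pos ∧ d.out = c.2.out ∧
    ∀ v : V, d.head v = (c.2.stack v).length ∧ HoldsStack (d.tape v) (c.2.stack v)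

variable [Finite V] [Finite S] {P : StackMachine V S α β}

theorem TMRel.read {c : P.Q × Store V S β} {d : P.toTM.Cfg} (h : P.TMRel c d) :
    (fun k => d.tape k (d.head k)) = c.2.tops := by
  funext v
  rw [(h.2.2.2 v).1]
  exact (h.2.2.2 v).2.top

theorem TMRel.step {x : List α} {c c' : P.Q × Store V S β} {d : P.toTM.Cfg}
    (hc : P.step x c = some c') (h : P.TMRel c d) :
    ∃ d', StepsTo (P.toTM.step x) 2 d d' ∧ P.TMRel c' d' := by
  have hread := h.read
  obtain ⟨h₁, h₂, h₃, h₄⟩ := h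
  simp only [StackMachine.step, Option.map_eq_some_iff] at hc
  obtain ⟨a, ha, rfl⟩ := hc
  -- The intermediate configuration: the heads have moved, the tapes are unchanged, and the symbols
  -- to be pushed are kept in the state.
  refine ⟨_, .head (b := ⟨(a.next, some fun v => (a.op v).push), a.inMove.applyInput x.length
    d.inPos, d.tape, fun v => ((a.op v).headMove (c.2.tops v)).applyWork (d.head v),
    d.out ++ a.emit.toList⟩) ?_ (.single rfl), rfl, ?_, ?_, ?_⟩
  · simp only [TM.step, h₁, h₂]
    rw [hread]
    simp only [toTM, ha, Option.map_some, Option.some.injEq, TM.Cfg.mk.injEq, true_and, and_true]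
    funext v
    rw [← hread]
    simp
  · simp [StackAction.apply, h₂, HeadMove.applyInput]
  · simp [StackAction.apply, h₃]
  · intro v
    obtain ⟨hh, hs⟩ := h₄ v
    obtain ⟨e₁, e₂⟩ := hs.apply (a.op v)
    simp only [Store.tops, hh, e₁, StackAction.apply]
    exact ⟨rfl, e₂⟩

theorem toTM_haltsWith {x : List α} {b : ℕ} {s : Store V S β}
    (h : P.RunsIn x ⟨0, fun _ => [], []⟩ b s) : ∃ t ≤ 2 * b, P.toTM.HaltsWith x t s.out := by
  obtain ⟨t, ht, q, h, e⟩ := h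
  obtain ⟨d, hd, hR⟩ := h.simulate P.TMRel 2 (fun _ _ _ => TMRel.step) (d := P.toTM.initCfg)
    ⟨rfl, rfl, rfl, fun _ => ⟨rfl, rfl⟩⟩
  refine ⟨2 * t, by omega, d, TM.cfgAt_eq_some_of_stepsTo hd, ?_, hR.2.2.1⟩
  have hread := hR.read
  obtain ⟨h₁, h₂, -, -⟩ := hR
  simp only [StackMachine.step, Option.map_eq_none_iff] at e
  simp only [TM.step, h₁, h₂]
  rw [hread]
  simp [toTM, e]

/-- A function computed by a stack machine in polynomial time, with input and output on two of
the stacks. -/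
theorem polyTimeComputable {f : List α → List β} [DecidableEq V]
    (P : StackMachine V S α β) (u w : V)
    (e : α → S) (d : S → Option β) (p q : Polynomial ℕ)
    (h : ∀ x, ∃ s : Store V S β, s.out = [] ∧ (s.stack w).length ≤ q.eval x.length ∧
      (s.stack w).filterMap d = f x ∧
      P.RunsIn x ⟨0, fun v => if v = u then x.map e else [], []⟩ (p.eval x.length) s) : PolyTimeComputable f := by
  refine ⟨(seq (loadInput u e) (seq P (emitStack w d))).toTM,
    -- Loading takes `6 * n + 6` steps, `P` takes `p`, emitting `3 * q`, the two compositions one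
    -- each; the Turing machine doubles the sum.
    2 * (6 * Polynomial.X + 8 + p + 3 * q), fun x => ?_⟩
  obtain ⟨s, hs, hq, hf, hP⟩ := h x
  have := seq_runsIn (loadInput_runsIn u e x []) (seq_runsIn hP (emitStack_runsIn w d x s))
  obtain ⟨t, ht, hh⟩ := toTM_haltsWith this
  refine ⟨t, ht.trans ?_, by simpa [hs, hf] using hh⟩
  simp
  omega

end StackMachine

/-! ### Stack machines simulate Turing machines -/

/-- The stacks for the simulation of a machine with work tapes indexed by `K`: one for the output,
and for the input tape and each work tape two, for the cells to the left of the head (`false`) and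
for the remaining ones (`true`). -/
abbrev SimStack (K : Type) : Type := Option (Option K × Bool)

/-- The tape `T` with the head at `h` is represented by the stacks `l` and `r`; cells beyond are
blank. -/
def SplitTape {S Γ : Type} (d : S → Γ) (blank : Γ) (T : ℕ → Γ) (h : ℕ) (l r : List S) : Prop :=
  l.length = h ∧ ∀ i, T i = ((l.reverse ++ r)[i]?).elim blank d

namespace SplitTape

variable {S Γ : Type} {d : S → Γ} {blank : Γ} {T : ℕ → Γ} {h : ℕ} {l r : List S}

theorem read (H : SplitTape d blank T h l r) : T h = r.head?.elim blank d := by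
  rw [H.2 h, List.getElem?_append_right (by simp [H.1])]
  simp [H.1, List.head?_eq_getElem?]

/-- An empty `r` means that the head is on a blank cell not yet represented; with `r.tail` this case
needs no separate treatment. -/
theorem write (H : SplitTape d blank T h l r) {a : Γ} {s : S} (hs : d s = a) :
    SplitTape d blank (Function.update T h a) h l (s :: r.tail) := by
  refine ⟨H.1, fun i => ?_⟩
  have hl := H.1
  rcases lt_trichotomy i h with hi | rfl | hi
  · rw [Function.update_of_ne hi.ne, H.2 i, List.getElem?_append_left (by simpa [hl] using hi),
      List.getElem?_append_left (by simpa [hl] using hi)]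
  · simp [← hl, hs]
  · rw [Function.update_of_ne hi.ne', H.2 i, List.getElem?_append_right (by simp; omega),
      List.getElem?_append_right (by simp; omega)]
    obtain ⟨j, rfl⟩ : ∃ j, i = h + 1 + j := ⟨i - (h + 1), by omega⟩
    have : h + 1 + j - l.reverse.length = j + 1 := by simp; omega
    rw [this]
    simp

theorem right {s : S} (H : SplitTape d blank T h l (s :: r)) :
    SplitTape d blank T (h + 1) (s :: l) r :=
  ⟨by simp [H.1], fun i => by simpa using H.2 i⟩

/-- In cell `0` the left stack is empty, so nothing moves, in agreement with the convention for the
head. -/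
theorem left (H : SplitTape d blank T h l r) :
    SplitTape d blank T (h - 1) l.tail (l.head?.toList ++ r) := by
  cases l with
  | nil => simpa [← H.1] using H
  | cons s l => exact ⟨by simp [← H.1], fun i => by simpa using H.2 i⟩

end SplitTape

/-- How to simulate the machine `M` on the stacks `V` with symbols `S`: the stacks to be used and
the codes of the cells of the input tape (`none` for the left end), of the symbols on the work
tapes and of the output letters. -/
structure SimCode {α β : Type} (M : TM α β) (V S : Type) where
  ι : SimStack M.K → V
  inp : Option α → S
  sym : M.Γ → S
  letter : β → S
  ι_inj : Function.Injective ι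
  inp_inj : Function.Injective inp
  sym_inj : Function.Injective sym

namespace SimCode

variable {α β α' β' V S : Type} {M : TM α β} (C : SimCode M V S)

/-- The input cell with a given code. -/
noncomputable def cell (s : S) : InputCell α :=
  Function.extend C.inp (fun a => a.elim .leftEnd .letter) (fun _ => .rightEnd) s

/-- The work tape symbol with a given code. -/
noncomputable def symbol (s : S) : M.Γ := Function.extend C.sym id (fun _ => M.blank) s

@[simp] theorem cell_inp (a : Option α) : C.cell (C.inp a) = a.elim .leftEnd .letter :=
  C.inp_inj.extend_apply _ _ _

@[simp] theorem symbol_sym (a : M.Γ) : C.symbol (C.sym a) = a :=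
  C.sym_inj.extend_apply _ _ _

/-- The operation on the left or right stack of a tape (given by the Boolean) that moves the head;
`l` and `r` are the top symbols. -/
def _root_.HeadMove.shift {S : Type} (m : HeadMove) (l r : Option S) (b : Bool) : StackOp S :=
  match m, b with
  | .left, false => ⟨true, none⟩
  | .left, true => ⟨false, l⟩
  | .stay, _ => .nop
  | .right, true => ⟨true, none⟩
  | .right, false => ⟨false, r⟩

/-- The operations for an action of `M`, with the left moves on work tapes still to be done. -/
def firstOp (a : TMAction M.Q M.K M.Γ β) (t : V → Option S) : SimStack M.K → StackOp S
  | none => ⟨false, a.emit.map C.letter⟩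
  | some (none, b) =>
    a.inMove.shift (t (C.ι (some (none, false)))) (t (C.ι (some (none, true)))) b
  | some (some k, b) =>
    match a.move k, b with
    | .right, true => ⟨true, none⟩
    | .right, false => ⟨false, some (C.sym (a.write k))⟩
    | _, true => ⟨true, some (C.sym (a.write k))⟩
    | _, false => .nop

/-- The operations for the left moves on the work tapes in `m`. -/
def secondOp (m : M.K → Bool) (t : V → Option S) : SimStack M.K → StackOp S
  | some (some k, b) =>
    bif m k then HeadMove.left.shift (t (C.ι (some (some k, false)))) none b else .nop
  | _ => .nop

def _root_.HeadMove.isLeft : HeadMove → Bool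
  | .left => true
  | _ => false

/-- The stack machine that simulates `M`, in two steps for each step. -/
noncomputable def machine : StackMachine V S α' β' where
  Q := M.Q × Option (M.K → Bool)
  finQ := by
    have := M.finQ
    have := M.finK
    infer_instance
  start := (M.start, none)
  δ := fun q _ t =>
    match q with
    | (q, none) =>
      (M.δ q ((t (C.ι (some (none, true)))).elim .rightEnd C.cell)
        (fun k => (t (C.ι (some (some k, true)))).elim M.blank C.symbol)).map fun a =>
          ⟨(a.next, some fun k => (a.move k).isLeft), .stay,
            Function.extend C.ι (C.firstOp a t) (fun _ => .nop), none⟩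
    | (q, some m) =>
      some ⟨(q, none), .stay, Function.extend C.ι (C.secondOp m t) (fun _ => .nop), none⟩

/-- The configuration `c` of `M` on input `x` is represented by the stacks `σ`. -/
def Represents (x : List α) (c : M.Cfg) (σ : V → List S) : Prop :=
  ((σ (C.ι (some (none, false)))).reverse ++ σ (C.ι (some (none, true))) =
      C.inp none :: x.map fun a => C.inp (some a)) ∧
  (σ (C.ι (some (none, false)))).length = c.inPos ∧
  (∀ k, SplitTape C.symbol M.blank (c.tape k) (c.head k)
    (σ (C.ι (some (some k, false)))) (σ (C.ι (some (some k, true))))) ∧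
  σ (C.ι none) = (c.out.map C.letter).reverse

variable {C} {x : List α} {c : M.Cfg}

theorem Represents.readInput {σ : V → List S} (h : C.Represents x c σ) :
    ((σ (C.ι (some (none, true)))).head?).elim .rightEnd C.cell = inputCellAt x c.inPos := by
  obtain ⟨h₁, h₂, -⟩ := h
  have : (σ (C.ι (some (none, true)))).head? =
      (C.inp none :: x.map fun a => C.inp (some a))[c.inPos]? := by
    rw [← h₁, List.getElem?_append_right (by simp [h₂])]
    simp [h₂, List.head?_eq_getElem?]
  rw [this]
  rcases hp : c.inPos with _ | p
  · simp [inputCellAt]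
  · simp only [List.getElem?_cons_succ, List.getElem?_map, inputCellAt]
    cases x[p]? <;> simp

/-- The right end marker has no code; it is represented by an empty right stack. There a right move
pops and pushes nothing, and this is the clamping at `n + 1`. -/
theorem shift_input {l r full : List S} {n p : ℕ} (m : HeadMove)
    (h : l.reverse ++ r = full) (hl : l.length = p) (hn : full.length = n + 1) :
    ((m.shift l.head? r.head? false).apply l).reverse ++ (m.shift l.head? r.head? true).apply r
      = full ∧ ((m.shift l.head? r.head? false).apply l).length = m.applyInput n p := by
  subst h hl
  simp only [List.length_append, List.length_reverse] at hn
  rcases m with _ | _ | _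
  · cases l <;> simp [HeadMove.shift, HeadMove.applyInput]
  · simp [HeadMove.shift, HeadMove.applyInput]
  · cases r with
    | nil => simp at hn; simp [HeadMove.shift, HeadMove.applyInput]; omega
    | cons s r => simp at hn; simp [HeadMove.shift, HeadMove.applyInput]; omega

/-- Writing replaces the top of the right stack. A left move then needs a second push on the same
stack, which one operation cannot do, so it waits for the second step. The input tape is never
written on and is shifted at once. -/
theorem Represents.step {x' : List α'} {s : Store V S β'} {c' : M.Cfg}
    (hc : M.step x c = some c') (h : C.Represents x c s.stack) :
    ∃ σ, StepsTo ((C.machine (α' := α') (β' := β')).step x') 2 ((c.state, none), s)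
        ((c'.state, none), s.withStack σ) ∧
      C.Represents x c' σ ∧ ∀ v ∉ Set.range C.ι, σ v = s.stack v := by
  have hin := h.readInput
  obtain ⟨h₁, h₂, h₃, h₄⟩ := h
  have hread : (fun k => (s.tops (C.ι (some (some k, true)))).elim M.blank C.symbol) =
      fun k => c.tape k (c.head k) := funext fun k => (h₃ k).read.symm
  simp only [TM.step, Option.map_eq_some_iff] at hc
  obtain ⟨a, ha, rfl⟩ := hc
  let s₁ : Store V S β' := s.withStack fun v =>
    (Function.extend C.ι (C.firstOp a s.tops) (fun _ => StackOp.nop) v).apply (s.stack v)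
  let s₂ : Store V S β' := s.withStack fun v =>
    (Function.extend C.ι (C.secondOp (fun k => (a.move k).isLeft) s₁.tops)
      (fun _ => StackOp.nop) v).apply (s₁.stack v)
  have e₁ : ∀ j, s₁.stack (C.ι j) = (C.firstOp a s.tops j).apply (s.stack (C.ι j)) := fun j => by
    simp only [s₁, Store.withStack, C.ι_inj.extend_apply]
  have e₂ : ∀ j, s₂.stack (C.ι j) = (C.secondOp (fun k => (a.move k).isLeft) s₁.tops j).apply
      (s₁.stack (C.ι j)) := fun j => by
    simp only [s₂, Store.withStack, C.ι_inj.extend_apply]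
  refine ⟨s₂.stack, .head (b := ((a.next, some fun k => (a.move k).isLeft), s₁)) ?_
    (.single ?_), ⟨?_, ?_, ?_, ?_⟩, ?_⟩
  · simp only [StackMachine.step, machine]
    rw [hread]
    simp only [Store.tops] at hin ⊢
    rw [hin, ha]
    simp [StackAction.apply, s₁, Store.withStack, HeadMove.applyInput]
  · simp [StackMachine.step, machine, StackAction.apply, s₁, s₂, Store.withStack,
      HeadMove.applyInput]
  · simp only [e₂, e₁, secondOp, firstOp, StackOp.nop_apply]
    exact (shift_input (n := x.length) a.inMove h₁ h₂ (by simp)).1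
  · simp only [e₂, e₁, secondOp, firstOp, StackOp.nop_apply]
    exact (shift_input (n := x.length) a.inMove h₁ h₂ (by simp)).2
  · intro k
    have hw := (h₃ k).write (C.symbol_sym (a.write k))
    simp only [e₂, e₁, secondOp, firstOp]
    rcases hm : a.move k with _ | _ | _
    · have e₃ : s₁.tops (C.ι (some (some k, false))) =
          (s.stack (C.ι (some (some k, false)))).head? := by
        simp [Store.tops, e₁, firstOp, hm]
      simpa [HeadMove.isLeft, HeadMove.shift, HeadMove.applyWork, e₃] using hw.left
    · simpa [HeadMove.isLeft, HeadMove.shift, HeadMove.applyWork] using hw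
    · simpa [HeadMove.isLeft, HeadMove.shift, HeadMove.applyWork] using hw.right
  · simp only [e₂, e₁, secondOp, firstOp, StackOp.nop_apply, h₄]
    cases a.emit <;> simp
  · intro v hv
    have hv' : ¬ ∃ j, C.ι j = v := hv
    simp [s₂, s₁, Store.withStack, Function.extend_apply' _ _ _ hv']

/-- The run of `M` on an input that lies on the stack for the right half of the input tape. -/
theorem machine_runsIn {x' : List α'} {s : Store V S β'} {t : ℕ} {y : List β}
    (hM : M.HaltsWith x t y)
    (hin : s.stack (C.ι (some (none, true))) = C.inp none :: x.map fun a => C.inp (some a))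
    (hs : ∀ j, j ≠ some (none, true) → s.stack (C.ι j) = []) :
    ∃ σ, (C.machine (α' := α') (β' := β')).RunsIn x' s (2 * t) (s.withStack σ) ∧
      σ (C.ι none) = (y.map C.letter).reverse ∧ ∀ v ∉ Set.range C.ι, σ v = s.stack v := by
  obtain ⟨c, hc, he, rfl⟩ := hM
  obtain ⟨d, hd, σ, rfl, hR, hσ⟩ := (TM.stepsTo_of_cfgAt_eq_some hc).simulate
    (step' := (C.machine (α' := α') (β' := β')).step x')
    (fun c d => ∃ σ, d = ((c.state, none), s.withStack σ) ∧ C.Represents x c σ ∧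
      ∀ v ∉ Set.range C.ι, σ v = s.stack v) 2 (by
      rintro a b d hab ⟨σ, rfl, hR, hσ⟩
      obtain ⟨σ', h₁, h₂, h₃⟩ := Represents.step (x' := x') (s := s.withStack σ) hab hR
      exact ⟨_, h₁, σ', rfl, h₂, fun v hv => (h₃ v hv).trans (hσ v hv)⟩)
    (d := ((M.start, none), s))
    ⟨s.stack, rfl, ⟨by simp [hin, hs], by simp [hs, TM.initCfg],
      fun k => ⟨by simp [hs, TM.initCfg], by simp [hs, TM.initCfg]⟩,
      by simp [hs, TM.initCfg]⟩, fun _ _ => rfl⟩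
  refine ⟨σ, ⟨2 * t, le_rfl, _, hd, ?_⟩, hR.2.2.2, hσ⟩
  have hin := hR.readInput
  have hread : (fun k => ((s.withStack σ).tops (C.ι (some (some k, true)))).elim M.blank
      C.symbol) = fun k => c.tape k (c.head k) := funext fun k => (hR.2.2.1 k).read.symm
  simp only [TM.step, Option.map_eq_none_iff] at he
  simp only [StackMachine.step, machine]
  rw [hread]
  simp only [Store.tops, Store.withStack] at hin ⊢
  rw [hin, he]
  rfl

variable (C)

open Classical in
/-- The simulation, started with the encoded input on the stack for the right half of the input
tape. -/
noncomputable def call : StackMachine V S α' β' :=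
  .seq (.stackPrim fun _ v => if v = C.ι (some (none, true)) then ⟨false, some (C.inp none)⟩
    else .nop) C.machine

variable {C}

/-- The last clause is a frame condition: stacks outside the range of `C.ι` keep their contents, so
several simulations can share one machine. The output arrives reversed, its last letter on top. -/
theorem call_runsIn {x' : List α'} {s : Store V S β'} {t : ℕ} {y : List β}
    (hM : M.HaltsWith x t y)
    (hin : s.stack (C.ι (some (none, true))) = x.map fun a => C.inp (some a))
    (hs : ∀ j, j ≠ some (none, true) → s.stack (C.ι j) = []) :
    ∃ σ, (C.call (α' := α') (β' := β')).RunsIn x' s (2 * t + 2) (s.withStack σ) ∧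
      σ (C.ι none) = (y.map C.letter).reverse ∧ ∀ v ∉ Set.range C.ι, σ v = s.stack v := by
  classical
  have h₁ := StackMachine.stackPrim_runsIn (fun _ v => if v = C.ι (some (none, true)) then
    (⟨false, some (C.inp none)⟩ : StackOp S) else .nop) x' s
  obtain ⟨σ, h₂, h₃, h₄⟩ := machine_runsIn (C := C) (x' := x') (s := s.withStack fun v =>
    (if v = C.ι (some (none, true)) then (⟨false, some (C.inp none)⟩ : StackOp S)
      else .nop).apply (s.stack v)) hM (by simp [Store.withStack, hin])
    (fun j hj => by simp [Store.withStack, C.ι_inj.eq_iff, hj, hs])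
  refine ⟨σ, (StackMachine.seq_runsIn h₁ h₂).cast (by omega) rfl, h₃, fun v hv => ?_⟩
  rw [h₄ v hv]
  have : v ≠ C.ι (some (none, true)) := fun h => hv ⟨_, h.symm⟩
  simp [Store.withStack, this]

end SimCode

/-! ### Closure properties of polynomial-time functions -/

theorem Polynomial.eval_mono_nat (p : Polynomial ℕ) : Monotone fun n => p.eval n := by
  intro m n h
  induction p using Polynomial.induction_on' with
  | add p q hp hq => simpa using add_le_add hp hq
  | monomial k a => simpa using Nat.mul_le_mul_left a (Nat.pow_le_pow_left h k)

theorem TM.HaltsWith.length_le {α β : Type} {M : TM α β} {x : List α} {t : ℕ} {y : List β}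
    (h : M.HaltsWith x t y) : y.length ≤ t := by
  obtain ⟨c, hc, -, rfl⟩ := h
  have key : ∀ {n : ℕ} {a b : M.Cfg}, StepsTo (M.step x) n a b →
      b.out.length ≤ a.out.length + n := by
    intro n a b h
    induction h with
    | refl => simp
    | @head n a b c h₁ _ ih =>
      simp only [TM.step, Option.map_eq_some_iff] at h₁
      obtain ⟨act, -, rfl⟩ := h₁
      have : act.emit.toList.length ≤ 1 := by cases act.emit <;> simp
      simp only [List.length_append] at ih
      omega
  simpa [TM.initCfg] using key (TM.stepsTo_of_cfgAt_eq_some hc)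

namespace PolyTimeComputable

variable {α β γ : Type}

theorem length_le {f : List α → List β} (hf : PolyTimeComputable f) :
    ∃ p : Polynomial ℕ, ∀ x, (f x).length ≤ p.eval x.length := by
  obtain ⟨M, p, h⟩ := hf
  refine ⟨p, fun x => ?_⟩
  obtain ⟨t, ht, h⟩ := h x
  exact h.length_le.trans ht

/-- Pouring the reversed output of the first simulation onto the input stack of the second restores
its order. The second running time is bounded through `|f x| ≤ p₁ |x|` and the monotonicity of `p₂`.
-/
theorem comp [Finite α] [Finite β] [Finite γ] {g : List β → List γ} {f : List α → List β}
    (hg : PolyTimeComputable g) (hf : PolyTimeComputable f) :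
    PolyTimeComputable fun x => g (f x) := by
  classical
  obtain ⟨M₁, p₁, h₁⟩ := hf
  obtain ⟨M₂, p₂, h₂⟩ := hg
  have := M₁.finK
  have := M₁.finΓ
  have := M₂.finK
  have := M₂.finΓ
  let V := SimStack M₁.K ⊕ SimStack M₂.K ⊕ Unit
  let S := (Option α ⊕ M₁.Γ) ⊕ (Option β ⊕ M₂.Γ) ⊕ γ
  -- The output letters of `M₁` get the codes that `C₂` uses for input letters, so no recoding is
  -- needed in between.
  let C₁ : SimCode M₁ V S := ⟨.inl, fun a => .inl (.inl a), fun a => .inl (.inr a),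
    fun b => .inr (.inl (.inl (some b))), Sum.inl_injective,
    Sum.inl_injective.comp Sum.inl_injective, Sum.inl_injective.comp Sum.inr_injective⟩
  let C₂ : SimCode M₂ V S := ⟨fun j => .inr (.inl j), fun b => .inr (.inl (.inl b)),
    fun a => .inr (.inl (.inr a)), fun c => .inr (.inr c),
    Sum.inr_injective.comp Sum.inl_injective,
    Sum.inr_injective.comp (Sum.inl_injective.comp Sum.inl_injective),
    Sum.inr_injective.comp (Sum.inl_injective.comp Sum.inr_injective)⟩
  let w : V := .inr (.inr ())
  let u : V := .inl (some (none, true))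
  let m : V := .inr (.inl (some (none, true)))
  refine StackMachine.polyTimeComputable
    (.seq C₁.call (.seq (.pour (C₁.ι none) (· = m)) (.seq C₂.call
      (.pour (C₂.ι none) (· = w))))) u w
    (fun a => .inl (.inl (some a))) (fun s => match s with | .inr (.inr c) => some c | _ => none)
    (5 * p₁ + 5 * p₂.comp p₁ + 7) (p₂.comp p₁) fun x => ?_
  obtain ⟨t₁, ht₁, h₁⟩ := h₁ x
  obtain ⟨t₂, ht₂, h₂⟩ := h₂ (f x)
  have hl := h₁.length_le.trans ht₁
  have ht₂' := ht₂.trans (p₂.eval_mono_nat hl)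
  have hl₂ := h₂.length_le.trans ht₂'
  obtain ⟨σ₁, r₁, o₁, e₁⟩ := C₁.call_runsIn (x' := x)
    (s := (⟨0, fun v => if v = u then x.map fun a => .inl (.inl (some a)) else [], []⟩ :
      Store V S γ)) h₁ (by simp [V, C₁, u]) (by intro j hj; simp [V, C₁, u, hj])
  have r₂ := StackMachine.pour_runsIn (C₁.ι none) (· = m) x
    (Store.withStack (⟨0, fun v => if v = u then x.map fun a => .inl (.inl (some a)) else [],
      []⟩ : Store V S γ) σ₁)
  have e₁' : ∀ j, σ₁ (.inr j) = [] := fun j => by rw [e₁ _ (by simp [V, C₁])]; simp [u]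
  simp only [Store.withStack_withStack, Store.stack_withStack, o₁] at r₂
  obtain ⟨σ₂, r₃, o₂, e₂⟩ := C₂.call_runsIn (x' := x)
    (s := Store.withStack (⟨0, fun v => if v = u then x.map fun a => .inl (.inl (some a)) else [],
      []⟩ : Store V S γ) fun v => if v = C₁.ι none then [] else
        if v = m then ((List.map C₁.letter (f x)).reverse).reverse ++ σ₁ v else σ₁ v) h₂
    (by simp [V, C₁, C₂, e₁', m]) (by intro j hj; simp [V, C₁, C₂, m, e₁', hj])
  have r₄ := StackMachine.pour_runsIn (C₂.ι none) (· = w) x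
    (Store.withStack (⟨0, fun v => if v = u then x.map fun a => .inl (.inl (some a)) else [],
      []⟩ : Store V S γ) σ₂)
  have e₂' : σ₂ w = [] := by
    rw [e₂ _ (by simp [V, C₂, w])]
    simp [V, C₁, e₁', w, m]
  simp only [Store.withStack_withStack, Store.stack_withStack, o₂] at r₃ r₄
  refine ⟨_, rfl, ?_, ?_, (StackMachine.seq_runsIn r₁ (StackMachine.seq_runsIn r₂
    (StackMachine.seq_runsIn r₃ r₄))).mono ?_⟩
  · simpa [V, C₂, w, e₂'] using hl₂
  · simp [V, C₂, w, e₂', List.filterMap_map]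
  · simp at ht₂' hl₂ ⊢
    omega

/-- Two pourings copy the input to both simulations in the right order. Results are collected on a
stack, so `g x` is poured first and `f x` on top of it. -/
theorem append [Finite α] [Finite β] {f g : List α → List β}
    (hf : PolyTimeComputable f) (hg : PolyTimeComputable g) :
    PolyTimeComputable fun x => f x ++ g x := by
  classical
  obtain ⟨M₁, p₁, h₁⟩ := hf
  obtain ⟨M₂, p₂, h₂⟩ := hg
  have := M₁.finK
  have := M₁.finΓ
  have := M₂.finK
  have := M₂.finΓ
  let V := SimStack M₁.K ⊕ SimStack M₂.K ⊕ Fin 3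
  let S := Option α ⊕ M₁.Γ ⊕ M₂.Γ ⊕ β
  let C₁ : SimCode M₁ V S := ⟨.inl, .inl, fun a => .inr (.inl a),
    fun b => .inr (.inr (.inr b)), Sum.inl_injective, Sum.inl_injective,
    Sum.inr_injective.comp Sum.inl_injective⟩
  let C₂ : SimCode M₂ V S := ⟨fun j => .inr (.inl j), .inl, fun a => .inr (.inr (.inl a)),
    fun b => .inr (.inr (.inr b)), Sum.inr_injective.comp Sum.inl_injective, Sum.inl_injective,
    Sum.inr_injective.comp (Sum.inr_injective.comp Sum.inl_injective)⟩
  let u : V := .inr (.inr 0)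
  let v' : V := .inr (.inr 1)
  let w : V := .inr (.inr 2)
  let m₁ : V := .inl (some (none, true))
  let m₂ : V := .inr (.inl (some (none, true)))
  refine StackMachine.polyTimeComputable
    (.seq (.pour u (· = v')) (.seq (.pour v' fun v => v = m₁ ∨ v = m₂) (.seq C₁.call
      (.seq C₂.call (.seq (.pour (C₂.ι none) (· = w)) (.pour (C₁.ι none) (· = w))))))) u w
    (fun a => .inl (some a)) (fun s => match s with | .inr (.inr (.inr c)) => some c | _ => none)
    (6 * Polynomial.X + 5 * p₁ + 5 * p₂ + 9) (p₁ + p₂) fun x => ?_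
  obtain ⟨t₁, ht₁, h₁⟩ := h₁ x
  obtain ⟨t₂, ht₂, h₂⟩ := h₂ x
  have hl₁ := h₁.length_le.trans ht₁
  have hl₂ := h₂.length_le.trans ht₂
  let s₀ : Store V S β := ⟨0, fun v => if v = u then x.map fun a => .inl (some a) else [], []⟩
  have r₁ := StackMachine.pour_runsIn u (· = v') x s₀
  have r₂ := StackMachine.pour_runsIn v' (fun v => v = m₁ ∨ v = m₂) x (s₀.withStack fun v =>
    if v = v' then (x.map fun a => .inl (some a)).reverse else [])
  obtain ⟨σ₁, r₃, o₁, e₁⟩ := C₁.call_runsIn (x' := x) (s := s₀.withStack fun v =>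
    if v = m₁ ∨ v = m₂ then x.map fun a => .inl (some a) else []) h₁
    (by simp [V, C₁, m₁]) (by intro j hj; simp [V, C₁, m₁, m₂, hj])
  simp only [Store.withStack_withStack, Store.stack_withStack] at r₃ e₁
  obtain ⟨σ₂, r₄, o₂, e₂⟩ := C₂.call_runsIn (x' := x) (s := s₀.withStack σ₁) h₂
    (by
      rw [Store.stack_withStack, e₁ _ (by simp [V, C₁, C₂])]
      simp [V, C₂, m₂])
    (by
      intro j hj
      rw [Store.stack_withStack, e₁ _ (by simp [V, C₁, C₂])]
      simp [V, C₂, m₁, m₂, hj])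
  simp only [Store.withStack_withStack, Store.stack_withStack] at r₄ e₂
  have e₁' : σ₂ (C₁.ι none) = (List.map C₁.letter (f x)).reverse := by
    rw [e₂ _ (by simp [V, C₁, C₂]), o₁]
  have ew : σ₂ w = [] := by
    rw [e₂ _ (by simp [V, C₂, w]), e₁ _ (by simp [V, C₁, w])]
    simp [V, w, m₁, m₂]
  have r₅ := StackMachine.pour_runsIn (C₂.ι none) (· = w) x (s₀.withStack σ₂)
  simp only [Store.withStack_withStack, Store.stack_withStack, o₂] at r₅
  have r₆ := StackMachine.pour_runsIn (C₁.ι none) (· = w) x (s₀.withStack fun v =>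
    if v = C₂.ι none then [] else if v = w then (g x).map C₂.letter else σ₂ v)
  refine ⟨_, ?_, ?_, ?_, (StackMachine.seq_runsIn (r₁.cast le_rfl ?_) (StackMachine.seq_runsIn
    (r₂.cast le_rfl ?_) (StackMachine.seq_runsIn r₃ (StackMachine.seq_runsIn r₄
      (StackMachine.seq_runsIn (r₅.cast le_rfl ?_) r₆))))).mono ?_⟩
  · rfl
  · simp [V, C₁, C₂, w]
    rw [show σ₂ (.inl none) = _ from e₁']
    simpa using add_le_add hl₁ hl₂
  · simp [V, C₁, C₂, w]
    rw [show σ₂ (.inl none) = _ from e₁']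
    simp [C₁, List.filterMap_map]
  · simp only [s₀, Store.withStack, Store.mk.injEq, true_and, and_true]
    funext v
    by_cases hu : v = u
    · simp [V, hu, u, v']
    · simp [hu]
  · simp only [s₀, Store.withStack, Store.mk.injEq, true_and, and_true]
    funext v
    by_cases hv : v = v'
    · simp [V, hv, v', m₁, m₂]
    · simp [hv]
  · congr 1
    funext v
    by_cases hv : v = C₂.ι none
    · simp [hv]
    · by_cases hw : v = w <;> simp [hv, hw, ew]
  · simp [s₀, C₁, C₂, w]
    rw [show σ₂ (.inl none) = _ from e₁']
    simp
    omega

/-- Iteration over the letters of a word, the step being computed on the word that consists of the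
letter and the current state. -/
theorem foldl [Finite α] [Finite β] {h : List (α ⊕ β) → List β} (hh : PolyTimeComputable h)
    (q : Polynomial ℕ)
    (hq : ∀ x : List α, (x.foldl (fun s a => h (.inl a :: s.map .inr)) []).length ≤
      q.eval x.length) :
    PolyTimeComputable fun x : List α => x.foldl (fun s a => h (.inl a :: s.map .inr)) [] := by
  classical
  obtain ⟨M, p, hM⟩ := hh
  have := M.finK
  have := M.finΓ
  let V := SimStack M.K ⊕ Unit
  let S := Option (α ⊕ β) ⊕ M.Γ
  let C : SimCode M V S := ⟨.inl, .inl, .inr, fun b => .inl (some (.inr b)), Sum.inl_injective,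
    Sum.inl_injective, Sum.inr_injective⟩
  let u : V := .inr ()
  let w : V := .inl (some (none, true))
  let body : StackMachine V S α β :=
    .seq (.stackPrim fun t v => if v = u then ⟨true, none⟩ else if v = w then ⟨false, t u⟩
      else .nop) (.seq C.call (.seq (.clear fun v => v ∈ Set.range C.ι ∧ v ≠ C.ι none)
        (.pour (C.ι none) (· = w))))
  let F : List α → List β := fun x => x.foldl (fun s a => h (.inl a :: s.map .inr)) []
  let st : List α → List β → Store V S β := fun l s =>
    ⟨0, fun v => if v = u then l.map fun a => .inl (some (.inl a)) else if v = w then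
      s.map fun b => .inl (some (.inr b)) else [], []⟩
  -- With `t ≤ p (q + 1)`, a round takes 1 step to move the letter, `2 * t + 2` for the call, `3 *
  -- (q + 2 * t + 3)` to clear, at most `3 * t` to pour and 3 for the compositions.
  let B : Polynomial ℕ := 3 * q + 11 * p.comp (q + 1) + 20
  have hbody : ∀ (x : List α) (a : α) (l : List α) (s : List β), s.length ≤ q.eval x.length →
      body.RunsIn x (st (a :: l) s) (B.eval x.length) (st l (h (.inl a :: s.map .inr))) := by
    intro x a l s hs
    obtain ⟨t, ht, hrun⟩ := hM (.inl a :: s.map .inr)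
    have ht' : t ≤ p.eval (q.eval x.length + 1) :=
      ht.trans (p.eval_mono_nat (by simpa using hs))
    have hlen := hrun.length_le
    have r₁ := StackMachine.stackPrim_runsIn (fun (t : V → Option S) v =>
      if v = u then (⟨true, none⟩ : StackOp S) else if v = w then ⟨false, t u⟩
      else .nop) x (st (a :: l) s)
    obtain ⟨σ, r₂, o, e⟩ := C.call_runsIn (x' := x) (s := (st (a :: l) s).withStack fun v =>
        if v = u then l.map fun a => .inl (some (.inl a)) else if v = w then
          .inl (some (.inl a)) :: s.map fun b => .inl (some (.inr b)) else []) hrun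
      (by simp [V, C, st, u, w]) (by intro j hj; simp [V, C, st, u, w, hj])
    -- Nothing is known about what the simulation leaves behind, but a stack grows by at most one
    -- symbol per step.
    have hlen' : ∀ v, (v ∈ Set.range C.ι ∧ v ≠ C.ι none) →
        (σ v).length ≤ q.eval x.length + 1 + (2 * t + 2) := by
      rintro v ⟨⟨j, rfl⟩, hv⟩
      refine (r₂.length_le (C.ι j)).trans (Nat.add_le_add_right ?_ _)
      by_cases hj : j = some (none, true)
      · simpa [C, st, u, w, Store.tops, hj] using hs
      · simp [V, C, st, u, w, hj]
    have r₃ := StackMachine.clear_runsIn (fun v => v ∈ Set.range C.ι ∧ v ≠ C.ι none) x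
      ((st (a :: l) s).withStack σ) _ hlen'
    have r₄ := StackMachine.pour_runsIn (C.ι none) (· = w) x ((st (a :: l) s).withStack
      fun v => if v ∈ Set.range C.ι ∧ v ≠ C.ι none then [] else σ v)
    refine (StackMachine.seq_runsIn (r₁.cast le_rfl ?_) (StackMachine.seq_runsIn r₂
      (StackMachine.seq_runsIn r₃ r₄))).cast ?_ ?_
    · congr 1
      funext v
      by_cases hu : v = u
      · simp [hu, st]
      · by_cases hw : v = w <;> simp [hu, hw, st, Store.tops, u, w]
    · simp [o, B]
      omega
    · simp only [st, Store.withStack, Store.mk.injEq, true_and, and_true]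
      funext v
      rcases v with (_ | j) | _
      · simp [V, C, u, w]
      · by_cases hj : j = (none, true)
        · subst hj
          simp [V, C, u, w, o]
        · simp [V, C, u, w, hj]
      · have := e (.inr ()) (by simp [C])
        simpa [V, C, u, w] using this
  have hloop : ∀ (x l : List α) (z : List α), z ++ l = x →
      (StackMachine.loop (fun _ t => t u ≠ none) body).RunsIn x (st l (F z))
        ((B.eval x.length + 2) * l.length) (st [] (F x)) := by
    intro x l
    induction l with
    | nil =>
      rintro z rfl
      simp only [List.append_nil]
      exact (StackMachine.loop_runsIn_zero (by simp [st, u, Store.tops]))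
    | cons a l ih =>
      rintro z hz
      -- A prefix is itself a word, so `hq` bounds all intermediate states and not only the final
      -- one.
      have hs : (F z).length ≤ q.eval x.length :=
        (hq z).trans (q.eval_mono_nat (by simp [← hz]))
      have := ih (z ++ [a]) (by simpa using hz)
      have hF : F (z ++ [a]) = h (.inl a :: (F z).map .inr) := by simp [F]
      rw [hF] at this
      refine (StackMachine.loop_runsIn_succ ?_ (hbody x a l (F z) hs) this).mono ?_
      · simp [st, u, Store.tops]
      · simp only [List.length_cons]; ring_nf; rfl
  refine StackMachine.polyTimeComputable (.loop (fun _ t => t u ≠ none) body) u w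
    (fun a => .inl (some (.inl a)))
    (fun s => match s with | .inl (some (.inr b)) => some b | _ => none)
    ((B + 2) * Polynomial.X) q fun x => ⟨st [] (F x), rfl, ?_, ?_, ?_⟩
  · simpa [st, u, w] using hq x
  · simp [V, st, u, w, List.filterMap_map, F]
  · convert (hloop x x [] rfl).mono (b' := ((B + 2) * Polynomial.X).eval x.length) ?_ using 1
    · simp only [st, F, Store.mk.injEq, true_and, and_true]
      funext v
      by_cases hv : v = u <;> simp [hv]
    · simp

end PolyTimeComputable

/-! ### Transducers -/

/-- The output of a one-way transducer that emits at most one letter for each letter of the input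
and at most one letter at the end. -/
def transduce {Q α β : Type} (δ : Q → α → Q × Option β) (fin : Q → Option β) :
    Q → List α → List β
  | q, [] => (fin q).toList
  | q, a :: x => (δ q a).2.toList ++ transduce δ fin (δ q a).1 x

/-- A Turing machine without work tapes that computes `transduce δ fin q₀`. -/
def transducerTM {Q α β : Type} [Finite Q] (δ : Q → α → Q × Option β) (fin : Q → Option β)
    (q₀ : Q) : TM α β where
  Q := Option Q
  K := Empty
  Γ := Unit
  finQ := inferInstance
  finK := inferInstance
  finΓ := inferInstance
  start := some q₀
  blank := ()
  δ := fun q i _ => q.map fun q =>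
    match i with
    | .leftEnd => ⟨some q, .right, fun _ => (), fun _ => .stay, none⟩
    | .letter a => ⟨some (δ q a).1, .right, fun _ => (), fun _ => .stay, (δ q a).2⟩
    | .rightEnd => ⟨none, .stay, fun _ => (), fun _ => .stay, fin q⟩

/-- The letters of a word that come from the left alphabet. -/
def lefts {α β : Type} (x : List (α ⊕ β)) : List α := x.filterMap Sum.getLeft?

/-- The letters of a word that come from the right alphabet. -/
def rights {α β : Type} (x : List (α ⊕ β)) : List β := x.filterMap Sum.getRight?

section

variable {α β : Type}

@[simp] theorem lefts_nil : lefts ([] : List (α ⊕ β)) = [] := rfl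

@[simp] theorem rights_nil : rights ([] : List (α ⊕ β)) = [] := rfl

@[simp] theorem lefts_cons_inl (a : α) (x : List (α ⊕ β)) : lefts (.inl a :: x) = a :: lefts x :=
  rfl

@[simp] theorem lefts_cons_inr (b : β) (x : List (α ⊕ β)) : lefts (.inr b :: x) = lefts x := rfl

@[simp] theorem rights_cons_inl (a : α) (x : List (α ⊕ β)) : rights (.inl a :: x) = rights x :=
  rfl

@[simp] theorem rights_cons_inr (b : β) (x : List (α ⊕ β)) :
    rights (.inr b :: x) = b :: rights x := rfl

@[simp] theorem lefts_append (x y : List (α ⊕ β)) : lefts (x ++ y) = lefts x ++ lefts y :=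
  List.filterMap_append

@[simp] theorem rights_append (x y : List (α ⊕ β)) : rights (x ++ y) = rights x ++ rights y :=
  List.filterMap_append

@[simp] theorem lefts_map_inl (x : List α) : lefts (x.map (.inl : α → α ⊕ β)) = x := by
  induction x <;> simp_all

@[simp] theorem lefts_map_inr (x : List β) : lefts (x.map (.inr : β → α ⊕ β)) = [] := by
  induction x <;> simp_all

@[simp] theorem rights_map_inl (x : List α) : rights (x.map (.inl : α → α ⊕ β)) = [] := by
  induction x <;> simp_all

@[simp] theorem rights_map_inr (x : List β) : rights (x.map (.inr : β → α ⊕ β)) = x := by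
  induction x <;> simp_all

@[simp] theorem lefts_map_inl_comp {γ : Type} (f : γ → α) (x : List γ) :
    lefts (x.map ((Sum.inl : α → α ⊕ β) ∘ f)) = x.map f := by
  induction x <;> simp_all

@[simp] theorem lefts_map_inr_comp {γ : Type} (f : γ → β) (x : List γ) :
    lefts (x.map ((Sum.inr : β → α ⊕ β) ∘ f)) = [] := by
  induction x <;> simp_all

@[simp] theorem rights_map_inl_comp {γ : Type} (f : γ → α) (x : List γ) :
    rights (x.map ((Sum.inl : α → α ⊕ β) ∘ f)) = [] := by
  induction x <;> simp_all

@[simp] theorem rights_map_inr_comp {γ : Type} (f : γ → β) (x : List γ) :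
    rights (x.map ((Sum.inr : β → α ⊕ β) ∘ f)) = x.map f := by
  induction x <;> simp_all

@[simp] theorem rights_replicate_inl (n : ℕ) (a : α) :
    rights (List.replicate n (.inl a : α ⊕ β)) = [] := by
  rw [← List.map_replicate, rights_map_inl]

@[simp] theorem rights_replicate_inr (n : ℕ) (b : β) :
    rights (List.replicate n (.inr b : α ⊕ β)) = List.replicate n b := by
  rw [← List.map_replicate, rights_map_inr]

theorem length_lefts_add_length_rights (x : List (α ⊕ β)) :
    (lefts x).length + (rights x).length = x.length := by
  induction x with
  | nil => rfl
  | cons a x ih => rcases a with _ | _ <;> simp <;> omega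

end

open Classical in
/-- Properties of words that can be decided in polynomial time. -/
def PolyTimeDecidable {α : Type} (C : List α → Prop) : Prop :=
  PolyTimeComputable fun x => [decide (C x)]

namespace PolyTimeComputable

variable {α β γ Q : Type}

/-- One step for each letter and one for each end marker; the step at the right marker emits the
final letter. -/
theorem transduce [Finite Q] (δ : Q → α → Q × Option β) (fin : Q → Option β) (q₀ : Q) :
    PolyTimeComputable (transduce δ fin q₀) := by
  refine ⟨transducerTM δ fin q₀, Polynomial.X + 2, fun x => ⟨x.length + 2, by simp, ?_⟩⟩
  have key : ∀ (l pre : List α), pre ++ l = x → ∀ (q : Q) (c : (transducerTM δ fin q₀).Cfg),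
      c.state = some q → c.inPos = pre.length + 1 →
      ∃ c', StepsTo ((transducerTM δ fin q₀).step x) (l.length + 1) c c' ∧ c'.state = none ∧
        c'.out = c.out ++ _root_.transduce δ fin q l := by
    intro l
    induction l with
    | nil =>
      rintro pre rfl q c hq hp
      obtain ⟨c', hc', h₁, h₂⟩ : ∃ c', (transducerTM δ fin q₀).step (pre ++ []) c = some c' ∧
          c'.state = none ∧ c'.out = c.out ++ (fin q).toList := by
        simp [TM.step, hq, hp, transducerTM, StackMachine.inputCellAt_length_succ]
      exact ⟨c', .single hc', h₁, h₂⟩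
    | cons a l ih =>
      rintro pre rfl q c hq hp
      have hcell : inputCellAt (pre ++ a :: l) (pre.length + 1) = .letter a := by
        rw [StackMachine.inputCellAt_succ _ _ (by simp)]
        simp
      obtain ⟨c', h₁, h₂, h₃⟩ := ih (pre ++ [a]) (by simp) (δ q a).1
        ⟨some (δ q a).1, pre.length + 2, fun k => k.elim, fun k => k.elim,
          c.out ++ (δ q a).2.toList⟩ rfl (by simp)
      refine ⟨c', .head ?_ h₁, h₂, by simp [h₃, _root_.transduce]⟩
      simp only [TM.step, hq, hp, hcell, transducerTM, Option.map_some, Option.some.injEq,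
        HeadMove.applyInput, TM.Cfg.mk.injEq, true_and, and_true]
      refine ⟨by simp, ?_, ?_⟩ <;> (funext k; exact k.elim)
  obtain ⟨c, h₁, h₂, h₃⟩ := key x [] rfl q₀ ⟨some q₀, 1, fun k => k.elim, fun k => k.elim, []⟩
    rfl rfl
  refine ⟨c, TM.cfgAt_eq_some_of_stepsTo (.head ?_ h₁), ?_, by simpa using h₃⟩
  · simp only [TM.step, TM.initCfg, inputCellAt, transducerTM, Option.map_some,
      Option.some.injEq, HeadMove.applyInput, TM.Cfg.mk.injEq, true_and]
    refine ⟨by simp, ?_, ?_, by simp⟩ <;> (funext k; exact k.elim)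
  · simp [TM.step, transducerTM, h₂]

theorem filterMap (φ : α → Option β) : PolyTimeComputable (List.filterMap φ) := by
  convert transduce (Q := Unit) (fun _ a => ((), φ a)) (fun _ => none) () with x
  funext x
  induction x with
  | nil => rfl
  | cons a x ih => cases h : φ a <;> simp [_root_.transduce, h, ← ih]

theorem lefts : PolyTimeComputable (lefts : List (α ⊕ β) → List α) := filterMap _

theorem rights : PolyTimeComputable (rights : List (α ⊕ β) → List β) := filterMap _

theorem map (φ : α → β) : PolyTimeComputable (List.map φ) := by
  simpa using filterMap (fun a => some (φ a))

theorem singleton (b : β) : PolyTimeComputable fun _ : List α => [b] := by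
  convert transduce (Q := Unit) (fun _ (_ : α) => ((), none)) (fun _ => some b) () with x
  induction x with
  | nil => rfl
  | cons a x ih => simpa [_root_.transduce] using ih

theorem nil : PolyTimeComputable fun _ : List α => ([] : List β) := by
  convert filterMap (fun _ : α => (none : Option β)) with x
  simp

theorem id' : PolyTimeComputable fun x : List α => x := by
  convert map (id : α → α) with x
  simp

theorem tail : PolyTimeComputable (List.tail : List α → List α) := by
  have key : ∀ x : List α, _root_.transduce (fun (q : Bool) a => (true, bif q then some a else none))
      (fun _ => none) true x = x := by
    intro x
    induction x with
    | nil => rfl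
    | cons a x ih => simp [_root_.transduce, ih]
  convert transduce (fun (q : Bool) (a : α) => (true, bif q then some a else none))
    (fun _ => none) false
  funext x
  cases x with
  | nil => rfl
  | cons a x => simp [_root_.transduce, key]

/-! ### Decidable tests and case distinction -/

theorem _root_.PolyTimeDecidable.comp [Finite α] [Finite β] {C : List β → Prop}
    {f : List α → List β} (hC : PolyTimeDecidable C) (hf : PolyTimeComputable f) :
    PolyTimeDecidable fun x => C (f x) :=
  PolyTimeComputable.comp hC hf

theorem _root_.PolyTimeDecidable.head (c : Option α → Bool) :
    PolyTimeDecidable fun x : List α => c x.head? = true := by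
  have key : ∀ (x : List α) (b : Bool), _root_.transduce
      (fun q a => (some (q.getD (c (some a))), (none : Option Bool)))
      (fun q => some (q.getD (c none))) (some b) x = [b] := by
    intro x b
    induction x with
    | nil => rfl
    | cons a x ih => simpa [_root_.transduce] using ih
  unfold PolyTimeDecidable
  convert transduce (fun (q : Option Bool) (a : α) => (some (q.getD (c (some a))), none))
    (fun q => some (q.getD (c none))) none with x
  cases x with
  | nil =>
    simp only [_root_.transduce, Option.toList, Option.getD_none, List.cons.injEq, and_true]
    exact Bool.decide_eq_true
  | cons a x =>
    simp only [_root_.transduce, key, Option.toList, Option.getD_none, List.nil_append,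
      List.cons.injEq, and_true]
    exact Bool.decide_eq_true

theorem _root_.PolyTimeDecidable.getLast (c : Option α → Bool) :
    PolyTimeDecidable fun x : List α => c x.getLast? = true := by
  have key : ∀ (x : List α) (b : Bool), _root_.transduce
      (fun _ a => (c (some a), none)) (fun q => some q) b x =
        [x.getLast?.elim b fun a => c (some a)] := by
    intro x
    induction x with
    | nil => intro b; rfl
    | cons a x ih =>
      intro b
      have := ih (c (some a))
      rcases x with _ | ⟨a', x⟩
      · simp [_root_.transduce]
      · have h : (a' :: x).getLast? = some ((a' :: x).getLast (by simp)) :=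
          List.getLast?_eq_some_getLast _
        rw [List.getLast?_cons_cons, h]
        rw [h] at this
        exact this
  unfold PolyTimeDecidable
  convert transduce (fun (_ : Bool) (a : α) => (c (some a), none))
    (fun q => some q) (c none) with x
  rw [key]
  cases h : x.getLast? <;> simp [h]

-- A transducer that reads the bit of the condition followed by a word lets the word pass or
-- suppresses it. The case distinction is the concatenation of two words gated by opposite bits, one
-- of which is empty.
open Classical in
theorem ite [Finite α] [Finite β] {C : List α → Prop} {f g : List α → List β}
    (hC : PolyTimeDecidable C) (hf : PolyTimeComputable f) (hg : PolyTimeComputable g) :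
    PolyTimeComputable fun x => if C x then f x else g x := by
  let δ : Bool → Bool ⊕ β → Bool × Option β := fun q a =>
    match a with
    | .inl b => (b, none)
    | .inr y => (q, bif q then some y else none)
  have key : ∀ (y : List β) (b : Bool), _root_.transduce δ (fun _ => none) b (y.map .inr) =
      bif b then y else [] := by
    intro y b
    induction y with
    | nil => cases b <;> rfl
    | cons a y ih => cases b <;> simp_all [_root_.transduce, δ]
  have gate : ∀ {D : List α → Prop} {f : List α → List β}, PolyTimeDecidable D →
      PolyTimeComputable f → PolyTimeComputable fun x => if D x then f x else [] := by
    intro D f hD hf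
    convert (transduce δ (fun _ => none) false).comp
      (((map (Sum.inl (β := β))).comp hD).append ((map (Sum.inr (α := Bool))).comp hf)) with x
    by_cases h : D x <;> simp [_root_.transduce, h, key, δ]
  have hC' : PolyTimeDecidable fun x => ¬ C x := by
    unfold PolyTimeDecidable
    convert (map not).comp hC with x
    simp
  convert (gate hC hf).append (gate hC' hg) with x
  by_cases h : C x <;> simp [h]

/-! ### Arithmetic in unary and truncation -/

/-- One step of the truncation: the state consists of the remaining budget, in unary, and the
output; a unit increases the budget, a letter is put out if the budget permits. -/
def truncStep (β : Type) : Unit ⊕ β → List (Unit ⊕ β) → List (Unit ⊕ β)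
  | .inl _, s => .inl () :: s
  | .inr b, .inl _ :: s => s ++ [.inr b]
  | .inr _, s => s

@[simp] theorem truncStep_inl (a : Unit) (s : List (Unit ⊕ β)) :
    truncStep β (.inl a) s = .inl () :: s := rfl

@[simp] theorem truncStep_inr_inl (b : β) (a : Unit) (s : List (Unit ⊕ β)) :
    truncStep β (.inr b) (.inl a :: s) = s ++ [.inr b] := rfl

@[simp] theorem truncStep_inr_nil (b : β) : truncStep β (.inr b) [] = [] := rfl

@[simp] theorem truncStep_inr_inr (b c : β) (s : List (Unit ⊕ β)) :
    truncStep β (.inr b) (.inr c :: s) = .inr c :: s := rfl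

/-- The unused budget stands in front of the output, so each letter consumes the first unit and is
appended at the end; once the budget is spent, letters are dropped. -/
theorem foldl_truncStep (m : ℕ) (z y : List β) :
    (y.map .inr).foldl (fun s a => truncStep β a s)
        (List.replicate m (.inl ()) ++ z.map .inr) =
      List.replicate (m - y.length) (.inl ()) ++ (z ++ y.take m).map .inr := by
  induction y generalizing m z with
  | nil => simp
  | cons b y ih =>
    rcases m with _ | m
    · have h0 : truncStep β (.inr b) (z.map .inr) = z.map .inr := by cases z <;> rfl
      have := ih 0 z
      simp only [List.replicate_zero, List.nil_append] at this
      simp [h0, this]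
    · have := ih m (z ++ [b])
      simp only [List.map_append, List.map_cons, List.map_nil] at this
      simp only [List.map_cons, List.foldl_cons, List.replicate_succ, List.cons_append,
        truncStep_inr_inl, List.append_assoc, this]
      simp

theorem length_foldl_truncStep (x : List (Unit ⊕ β)) :
    (x.foldl (fun s a => truncStep β a s) []).length ≤ x.length := by
  induction x using List.reverseRecOn with
  | nil => simp
  | append_singleton x a ih =>
    simp only [List.foldl_append, List.foldl_cons, List.foldl_nil, List.length_append,
      List.length_singleton]
    generalize x.foldl (fun s a => truncStep β a s) [] = s at ih ⊢
    rcases a with _ | b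
    · simpa using ih
    · rcases s with _ | ⟨_ | c, s⟩ <;> simp at ih ⊢ <;> omega

/-- The function `h` has to agree with `H` only on words that code a letter and a state; its other
values are irrelevant. -/
theorem foldl' [Finite α] [Finite β] {H : α → List β → List β} {h : List (α ⊕ β) → List β}
    (hh : PolyTimeComputable h) (hH : ∀ a s, h (.inl a :: s.map .inr) = H a s)
    (q : Polynomial ℕ)
    (hq : ∀ x : List α, (x.foldl (fun s a => H a s) []).length ≤ q.eval x.length) :
    PolyTimeComputable fun x : List α => x.foldl (fun s a => H a s) [] := by
  simp only [← hH] at hq ⊢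
  exact foldl hh q hq

theorem truncate [Finite β] :
    PolyTimeComputable fun x : List (Unit ⊕ β) => x.foldl (fun s a => truncStep β a s) [] := by
  have c₁ := PolyTimeDecidable.head fun a : Option ((Unit ⊕ β) ⊕ (Unit ⊕ β)) =>
    match a with | some (.inl (.inl _)) => true | _ => false
  have c₂ := (PolyTimeDecidable.head fun a : Option ((Unit ⊕ β) ⊕ (Unit ⊕ β)) =>
    match a with | some (.inr (.inl _)) => true | _ => false).comp tail
  refine foldl' (ite c₁ ((singleton (.inl ())).append rights)
    (ite c₂ ((rights.comp (tail.comp tail)).append ((map .inr).comp (rights.comp lefts))) rights)) ?_ Polynomial.X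
    fun x => by simpa using length_foldl_truncStep x
  intro a s
  rcases a with _ | b
  · simp
  · rcases s with _ | ⟨_ | c, s⟩ <;> simp

/-- The fold reads all units of `u x` before the letters of `v x`, so the whole budget is available
when the first letter arrives. -/
theorem take [Finite α] [Finite β] {u : List α → List Unit} {v : List α → List β}
    (hu : PolyTimeComputable u) (hv : PolyTimeComputable v) :
    PolyTimeComputable fun x => (v x).take (u x).length := by
  convert rights.comp (truncate.comp
    (((map (Sum.inl (β := β))).comp hu).append ((map (Sum.inr (α := Unit))).comp hv))) with x
  have h : ∀ (l : List Unit) (m : ℕ), (l.map .inl).foldl (fun s a => truncStep β a s)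
      (List.replicate m (.inl ())) = List.replicate (m + l.length) (.inl ()) := by
    intro l
    induction l with
    | nil => simp
    | cons a l ih =>
      intro m
      simp only [List.map_cons, List.foldl_cons, truncStep_inl, ← List.replicate_succ, ih,
        List.length_cons]
      congr 1
      omega
  have h₁ := h (u x) 0
  have h₂ := foldl_truncStep (u x).length [] (v x)
  simp only [List.replicate_zero, zero_add, List.map_nil, List.append_nil] at h₁ h₂
  rw [List.foldl_append, h₁, h₂]
  simp only [List.nil_append, rights_append, rights_replicate_inl, rights_map_inr]

/-- One step of the multiplication: the state consists of the number of `inl`s and that of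
`inr`s; a unit from the left is added to the former, a unit from the right adds the former
to the latter. -/
def mulStep : Unit ⊕ Unit → List (Unit ⊕ Unit) → List (Unit ⊕ Unit)
  | .inl _, s => .inl () :: s
  | .inr _, s => s ++ List.replicate (s.countP Sum.isLeft) (.inr ())

@[simp] theorem mulStep_inl (a : Unit) (s : List (Unit ⊕ Unit)) :
    mulStep (.inl a) s = .inl () :: s := rfl

@[simp] theorem mulStep_inr (a : Unit) (s : List (Unit ⊕ Unit)) :
    mulStep (.inr a) s = s ++ List.replicate (s.countP Sum.isLeft) (.inr ()) := rfl

theorem countP_foldl_mulStep (x s : List (Unit ⊕ Unit)) :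
    (x.foldl (fun s a => mulStep a s) s).countP Sum.isLeft ≤ s.countP Sum.isLeft + x.length := by
  induction x generalizing s with
  | nil => simp
  | cons a x ih =>
    refine (ih _).trans ?_
    rcases a with _ | _ <;> simp [List.countP_cons, List.countP_replicate]; omega

/-- After `n` letters the state has at most `n` left units, so the next letter appends at most `n`
symbols, or one. -/
theorem length_foldl_mulStep (x : List (Unit ⊕ Unit)) :
    (x.foldl (fun s a => mulStep a s) []).length ≤ x.length * (x.length + 1) := by
  induction x using List.reverseRecOn with
  | nil => simp
  | append_singleton x a ih =>
    have := countP_foldl_mulStep x []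
    simp only [List.foldl_append, List.foldl_cons, List.foldl_nil, List.length_append,
      List.length_singleton]
    rcases a with _ | _ <;> simp at this ⊢ <;> nlinarith

/-- The units of `v x` are stored first; each unit of `u x` then adds their number to the right part
of the state. -/
theorem mul [Finite α] {u v : List α → List Unit}
    (hu : PolyTimeComputable u) (hv : PolyTimeComputable v) :
    PolyTimeComputable fun x => List.replicate ((u x).length * (v x).length) () := by
  have c₁ := PolyTimeDecidable.head fun a : Option ((Unit ⊕ Unit) ⊕ (Unit ⊕ Unit)) =>
    match a with | some (.inl (.inl _)) => true | _ => false
  have hF : PolyTimeComputable fun x => x.foldl (fun s a => mulStep a s) [] := by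
    refine foldl' (ite c₁ ((singleton (.inl ())).append rights) 
      (rights.append ((map fun _ => .inr ()).comp (lefts.comp rights)))) ?_
      (Polynomial.X * (Polynomial.X + 1)) fun x => by simpa using length_foldl_mulStep x
    intro a s
    have e : (_root_.lefts s).map (fun _ => (.inr () : Unit ⊕ Unit)) =
        List.replicate (s.countP Sum.isLeft) (.inr ()) := by
      induction s with
      | nil => rfl
      | cons a s ih => rcases a with _ | _ <;> simp [List.countP_cons, List.replicate_succ, ih]
    rcases a with _ | _ <;> simp [e]
  convert rights.comp (hF.comp
    (((map (Sum.inl (β := Unit))).comp hv).append ((map (Sum.inr (α := Unit))).comp hu))) with x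
  have e₁ : ∀ (l : List Unit) (m : ℕ), (l.map .inl).foldl (fun s a => mulStep a s)
      (List.replicate m (.inl ())) = List.replicate (m + l.length) (.inl ()) := by
    intro l
    induction l with
    | nil => simp
    | cons a l ih =>
      intro m
      simp only [List.map_cons, List.foldl_cons, mulStep_inl, ← List.replicate_succ, ih,
        List.length_cons]
      congr 1
      omega
  have e₂ : ∀ (l : List Unit) (m n : ℕ), (l.map .inr).foldl (fun s a => mulStep a s)
      (List.replicate m (.inl ()) ++ List.replicate n (.inr ())) =
        List.replicate m (.inl ()) ++ List.replicate (n + l.length * m) (.inr ()) := by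
    intro l
    induction l with
    | nil => simp
    | cons a l ih =>
      intro m n
      have hs : mulStep (.inr a) (List.replicate m (.inl ()) ++ List.replicate n (.inr ())) =
          List.replicate m (.inl ()) ++ List.replicate (n + m) (.inr ()) := by
        simp [List.countP_replicate]
      simp only [List.map_cons, List.foldl_cons, hs, ih, List.length_cons]
      congr 2
      ring
  have h₁ := e₁ (v x) 0
  have h₂ := e₂ (u x) (v x).length 0
  simp only [List.replicate_zero, zero_add, List.append_nil] at h₁ h₂
  rw [List.foldl_append, h₁, h₂]
  simp

/-- Constants, concatenation for sums and multiplication by the length of the input generate all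
polynomials; unary values serve as truncation budgets. -/
theorem polynomial [Finite α] (p : Polynomial ℕ) :
    PolyTimeComputable fun x : List α => List.replicate (p.eval x.length) () := by
  induction p using Polynomial.induction_on with
  | C a =>
    simp only [Polynomial.eval_C]
    induction a with
    | zero => exact nil
    | succ a ih =>
      convert ih.append (singleton ()) with x
      rw [List.replicate_succ']
  | add p q hp hq =>
    convert hp.append hq with x
    simp only [Polynomial.eval_add, List.replicate_add]
  | monomial n a ih =>
    convert ih.mul (map fun _ : α => ()) with x
    simp [pow_succ, mul_assoc]

end PolyTimeComputable

/-! ### Block-wise application to delimited lists -/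

theorem lefts_pairWord {α : Type} (x : List α) (y : List Bool) : lefts (pairWord x y) = x := by
  simp [pairWord]

theorem rights_pairWord {α : Type} (x : List α) (y : List Bool) : rights (pairWord x y) = y := by
  simp [pairWord]

/-! ### Self-delimiting codes for sequences of certificates -/

section Certificates

/-- A self-delimiting code for binary words. -/
def encodeWord (y : List Bool) : List Bool := y.flatMap (fun b => [true, b]) ++ [false]

/-- The first of a sequence of encoded words. -/
def firstWord : List Bool → List Bool :=
  transduce (fun (q : Fin 3) b =>
    match q with
    | 0 => (if b then 1 else 2, none)
    | 1 => (0, some b)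
    | 2 => (2, none)) (fun _ => none) 0

/-- What follows the first of a sequence of encoded words. -/
def dropWord : List Bool → List Bool :=
  transduce (fun (q : Fin 3) b =>
    match q with
    | 0 => (if b then 1 else 2, none)
    | 1 => (0, none)
    | 2 => (2, some b)) (fun _ => none) 0

/-- State 0 expects a flag, state 1 a bit of the word, and state 2 ignores what follows the closing
`false`. On arbitrary words the transducer still returns something, which matters for malformed
guesses. -/
theorem firstWord_encodeWord (y z : List Bool) : firstWord (encodeWord y ++ z) = y := by
  induction y with
  | nil =>
    simp only [firstWord, encodeWord, List.flatMap_nil, List.nil_append, List.cons_append,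
      transduce]
    induction z with
    | nil => rfl
    | cons b z ih => simpa [transduce] using ih
  | cons b y ih =>
    rw [firstWord, encodeWord] at ih
    simp only [firstWord, encodeWord, List.flatMap_cons, List.cons_append, List.nil_append,
      transduce, List.append_assoc] at ih ⊢
    simpa using ih

theorem dropWord_encodeWord (y z : List Bool) : dropWord (encodeWord y ++ z) = z := by
  induction y with
  | nil =>
    simp only [dropWord, encodeWord, List.flatMap_nil, List.nil_append, List.cons_append,
      transduce]
    induction z with
    | nil => rfl
    | cons b z ih => simpa [transduce] using ih
  | cons b y ih =>
    rw [dropWord, encodeWord] at ih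
    simp only [dropWord, encodeWord, List.flatMap_cons, List.cons_append, List.nil_append,
      transduce, List.append_assoc] at ih ⊢
    simpa using ih

theorem length_encodeWord (y : List Bool) : (encodeWord y).length = 2 * y.length + 1 := by
  simp [encodeWord]
  ring

theorem length_transduce_le {Q α β : Type} (δ : Q → α → Q × Option β) (q : Q) (x : List α) :
    (transduce δ (fun _ => none) q x).length ≤ x.length := by
  induction x generalizing q with
  | nil => simp [transduce]
  | cons a x ih =>
    have := ih (δ q a).1
    have h : (δ q a).2.toList.length ≤ 1 := by cases (δ q a).2 <;> simp
    simp only [transduce, List.length_append, List.length_cons]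
    omega

theorem length_firstWord_le (y : List Bool) : (firstWord y).length ≤ y.length :=
  length_transduce_le _ _ _

theorem length_dropWord_le (y : List Bool) : (dropWord y).length ≤ y.length :=
  length_transduce_le _ _ _

end Certificates

/-! ### Unique decomposition of delimited words -/

section ListWord

variable {α β : Type}

theorem listWord_cons (x : List α) (l : List (List α)) :
    listWord (x :: l) = none :: (x.map some ++ listWord l) := by
  simp [listWord]

/-- The blocks contain no delimiter, so the first block ends at the first delimiter after the
leading one and is determined by the word. -/
theorem listWord_injective : Function.Injective (listWord : List (List α) → List (Option α)) := by
  have key : ∀ (x y : List α) (u v : List (Option α)),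
      x.map some ++ none :: u = y.map some ++ none :: v → x = y ∧ u = v := by
    intro x
    induction x with
    | nil =>
      rintro (_ | ⟨b, y⟩) u v h
      · simpa using h
      · simp at h
    | cons a x ih =>
      rintro (_ | ⟨b, y⟩) u v h
      · simp at h
      · simp only [List.map_cons, List.cons_append, List.cons.injEq, Option.some.injEq] at h
        obtain ⟨rfl, rfl⟩ := ih y u v h.2 |>.imp_right id
        exact ⟨by rw [h.1], rfl⟩
  intro l
  induction l with
  | nil =>
    rintro (_ | ⟨y, m⟩) h
    · rfl
    · rw [listWord_cons] at h
      simp [listWord] at h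
  | cons x l ih =>
    rintro (_ | ⟨y, m⟩) h
    · rw [listWord_cons] at h
      simp [listWord] at h
    · rw [listWord_cons, listWord_cons] at h
      obtain ⟨rfl, h'⟩ := key x y _ _ (List.cons.inj h).2
      rw [ih (show listWord l = listWord m by simp only [listWord, h'])]

theorem head?_listWord (l : List (List α)) : (listWord l).head? = some none := rfl

theorem getLast?_listWord (l : List (List α)) : (listWord l).getLast? = some none := by
  induction l with
  | nil => rfl
  | cons x l ih =>
    rw [listWord_cons, ← List.cons_append, List.getLast?_append, ih]
    rfl

/-- Any word that begins and ends with the delimiter is well-formed, so well-formedness is tested on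
the first and last letters alone. -/
theorem exists_listWord {w : List (Option α)} (h : w.head? = some none)
    (h' : w.getLast? = some none) : ∃ l, w = listWord l := by
  obtain ⟨t, rfl⟩ : ∃ t, w = none :: t := by
    cases w with
    | nil => simp at h
    | cons a t => exact ⟨t, by simpa using h⟩
  clear h
  induction t with
  | nil => exact ⟨[], rfl⟩
  | cons a t ih =>
    rw [List.getLast?_cons_cons] at h'
    rcases a with _ | a
    · obtain ⟨l, hl⟩ := ih h'
      exact ⟨[] :: l, by rw [listWord_cons, ← hl]; rfl⟩
    · rcases t with _ | ⟨b, t⟩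
      · simp at h'
      · rw [List.getLast?_cons_cons] at h'
        -- The letter `a` is removed, the rest decomposed, and `a` put back in front of the first
        -- block, which exists because the rest is nonempty.
        obtain ⟨l, hl⟩ := ih (by rwa [List.getLast?_cons_cons])
        cases l with
        | nil => simp [listWord] at hl
        | cons x l =>
          rw [listWord_cons] at hl
          refine ⟨(a :: x) :: l, ?_⟩
          rw [listWord_cons, (List.cons.inj hl).2]
          rfl

theorem length_le_length_listWord (l : List (List α)) : l.length ≤ (listWord l).length := by
  induction l with
  | nil => simp
  | cons x l ih => rw [listWord_cons]; simp; omega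

theorem length_le_of_mem {x : List α} {l : List (List α)} (h : x ∈ l) :
    x.length ≤ (listWord l).length := by
  induction l with
  | nil => simp at h
  | cons y l ih =>
    rw [listWord_cons]
    rcases List.mem_cons.1 h with rfl | h
    · simp; omega
    · have := ih h
      simp; omega

theorem mem_SeqLang_listWord {X : Language α} {l : List (List α)} :
    listWord l ∈ SeqLang X ↔ ∃ x ∈ l, x ∈ X := by
  constructor
  · rintro ⟨l', h, hx⟩
    rwa [listWord_injective h]
  · exact fun h => ⟨l, rfl, h⟩

theorem nil_notMem_SeqLang {X : Language α} : [] ∉ SeqLang X := by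
  rintro ⟨l, h, -⟩
  simp [listWord] at h

end ListWord

/-! ### Applying a function to each block with its own certificate -/

variable {α β : Type}

/-- Application of `f` to the pairs of the words in `l` and the words encoded in `y`. -/
def zipWords (f : List (α ⊕ Bool) → List β) : List (List α) → List Bool → List (List β)
  | [], _ => []
  | x :: l, y => f (pairWord x (firstWord y)) :: zipWords f l (dropWord y)

/-- The state of the computation of `zipWords`: the remaining part of the encoded words, the part
of the result that has been computed and the current word of the list. -/
def zipState (c : List Bool) (d : List (Option β)) (u : List α) :
    List (Bool ⊕ (Option β ⊕ α)) :=
  c.map Sum.inl ++ (d.map Sum.inl ++ u.map Sum.inr).map Sum.inr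

/-- One step of the computation of `zipWords`. -/
def zipStep (f : List (α ⊕ Bool) → List β) :
    Bool ⊕ Option α → List (Bool ⊕ (Option β ⊕ α)) → List (Bool ⊕ (Option β ⊕ α))
  | .inl b, s => s ++ [.inl b]
  | .inr (some a), s => s ++ [.inr (.inr a)]
  | .inr none, s => zipState (dropWord (lefts s))
      (lefts (rights s) ++ (f (pairWord (rights (rights s)) (firstWord (lefts s)))).map some ++
        [none]) []

@[simp] theorem lefts_zipState (c : List Bool) (d : List (Option β)) (u : List α) :
    lefts (zipState c d u) = c := by simp [zipState]

@[simp] theorem rights_zipState (c : List Bool) (d : List (Option β)) (u : List α) :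
    rights (zipState c d u) = d.map Sum.inl ++ u.map Sum.inr := by simp [zipState]

@[simp] theorem zipStep_inl (f : List (α ⊕ Bool) → List β) (b : Bool) (c : List Bool) :
    zipStep f (.inl b) (zipState c [] []) = zipState (c ++ [b]) [] [] := by
  simp [zipStep, zipState]

@[simp] theorem zipStep_some (f : List (α ⊕ Bool) → List β) (a : α) (c : List Bool)
    (d : List (Option β)) (u : List α) :
    zipStep f (.inr (some a)) (zipState c d u) = zipState c d (u ++ [a]) := by
  simp [zipStep, zipState]

@[simp] theorem zipStep_none (f : List (α ⊕ Bool) → List β) (c : List Bool)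
    (d : List (Option β)) (u : List α) :
    zipStep f (.inr none) (zipState c d u) =
      zipState (dropWord c) (d ++ (f (pairWord u (firstWord c))).map some ++ [none]) [] := by
  simp [zipStep]

theorem foldl_zipStep_inl (f : List (α ⊕ Bool) → List β) (y c : List Bool) :
    (y.map Sum.inl).foldl (fun s a => zipStep f a s) (zipState c [] []) =
      zipState (c ++ y) [] [] := by
  induction y generalizing c with
  | nil => simp
  | cons b y ih => simp [ih]

theorem foldl_zipStep_some (f : List (α ⊕ Bool) → List β) (x : List α) (c : List Bool)
    (d : List (Option β)) (u : List α) :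
    (x.map fun a => .inr (some a)).foldl (fun s a => zipStep f a s) (zipState c d u) =
      zipState c d (u ++ x) := by
  induction x generalizing u with
  | nil => simp
  | cons b y ih => simp [ih]

/-- The leading delimiter is dropped, so that every delimiter read closes a block and triggers one
application of `f`. The leftover `c'` of the certificates is of no interest. -/
theorem foldl_zipStep (f : List (α ⊕ Bool) → List β) (l : List (List α)) (c : List Bool)
    (d : List (Option β)) :
    ∃ c', ((listWord l).tail.map Sum.inr).foldl (fun s a => zipStep f a s) (zipState c d []) =
      zipState c' (d ++ (listWord (zipWords f l c)).tail) [] := by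
  induction l generalizing c d with
  | nil => exact ⟨c, by simp [listWord, zipWords]⟩
  | cons x l ih =>
    obtain ⟨c', hc⟩ := ih (dropWord c) (d ++ (f (pairWord x (firstWord c))).map some ++ [none])
    refine ⟨c', ?_⟩
    have h : ∀ {γ : Type} (l : List (List γ)), listWord l = none :: (listWord l).tail :=
      fun _ => rfl
    rw [listWord_cons, List.tail_cons, h l, zipWords, listWord_cons, List.tail_cons,
      h (zipWords f l (dropWord c))]
    simp only [List.map_append, List.map_map, List.map_cons, List.foldl_append, List.foldl_cons]
    have := foldl_zipStep_some f x c d []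
    simp only [Function.comp_def, List.nil_append] at this ⊢
    rw [this, zipStep_none, hc]
    simp

/-- The fold lemma needs a bound for all inputs, including malformed ones. The unread certificates
and the current block together never exceed the number of letters read, and each step adds at most
`r + 1` letters to the result. -/
theorem length_foldl_zipStep (f : List (α ⊕ Bool) → List β) (r : Polynomial ℕ)
    (hr : ∀ x, (f x).length ≤ r.eval x.length) (x : List (Bool ⊕ Option α)) :
    (x.foldl (fun s a => zipStep f a s) []).length ≤
      2 * x.length * (r.eval x.length + 1) := by
  -- The induction runs over `z`, while `r` is evaluated at the fixed length of `x`, so that the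
  -- increment is the same in all steps.
  suffices h : ∀ z : List (Bool ⊕ Option α), z.length ≤ x.length →
      (lefts (z.foldl (fun s a => zipStep f a s) [])).length +
        (rights (rights (z.foldl (fun s a => zipStep f a s) []))).length ≤ z.length ∧
      (lefts (rights (z.foldl (fun s a => zipStep f a s) []))).length ≤
        z.length * (r.eval x.length + 1) by
    obtain ⟨h₁, h₂⟩ := h x le_rfl
    rw [← length_lefts_add_length_rights, ← length_lefts_add_length_rights (rights _)]
    nlinarith
  intro z
  induction z using List.reverseRecOn with
  | nil => simp
  | append_singleton z a ih =>
    intro hz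
    simp only [List.length_append, List.length_singleton] at hz
    obtain ⟨h₁, h₂⟩ := ih (by omega)
    simp only [List.foldl_append, List.foldl_cons, List.foldl_nil, List.length_append,
      List.length_singleton]
    generalize z.foldl (fun s a => zipStep f a s) [] = s at h₁ h₂ ⊢
    rcases a with b | _ | a
    · simp [zipStep]
      exact ⟨by omega, by nlinarith⟩
    · have hd := length_dropWord_le (lefts s)
      have hf := (hr (pairWord (rights (rights s)) (firstWord (lefts s)))).trans
        (r.eval_mono_nat (show _ ≤ x.length by
          have := length_firstWord_le (lefts s)
          simp [pairWord]
          omega))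
      simp only at hf
      simp [zipStep]
      exact ⟨by omega, by nlinarith⟩
    · simp [zipStep]
      exact ⟨by omega, by nlinarith⟩

open Classical in
/-- Application of `f` to the words in a delimited list, paired with words encoded in the second
component. -/
noncomputable def zipBlocks (f : List (α ⊕ Bool) → List β) (v : List (Option α ⊕ Bool)) :
    List (Option β) :=
  if (lefts v).head? = some none then
    if (lefts v).getLast? = some none then
      none :: lefts (rights (((rights v).map Sum.inl ++ (lefts v).tail.map Sum.inr).foldl
        (fun s a => zipStep f a s) []))
    else []
  else []

theorem zipBlocks_listWord (f : List (α ⊕ Bool) → List β) (l : List (List α)) (y : List Bool) :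
    zipBlocks f (pairWord (listWord l) y) = listWord (zipWords f l y) := by
  have h₁ := foldl_zipStep_inl f y []
  obtain ⟨c', h₂⟩ := foldl_zipStep f l y []
  have h₀ : (zipState [] [] [] : List (Bool ⊕ (Option β ⊕ α))) = [] := rfl
  simp only [h₀, List.nil_append] at h₁ h₂
  simp only [zipBlocks, lefts_pairWord, rights_pairWord, head?_listWord, getLast?_listWord,
    if_true, List.foldl_append, h₁, h₂, rights_zipState, List.map_nil, List.append_nil,
    lefts_map_inl]
  rfl

/-- The empty word lies in no `SeqLang`, so malformed words are treated uniformly, whatever the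
certificate. -/
theorem zipBlocks_of_not_listWord (f : List (α ⊕ Bool) → List β) (w : List (Option α))
    (y : List Bool) (h : ¬ ∃ l, w = listWord l) : zipBlocks f (pairWord w y) = [] := by
  rw [zipBlocks, lefts_pairWord]
  split_ifs with h₁ h₂
  · exact absurd (exists_listWord h₁ h₂) h
  · rfl
  · rfl

namespace PolyTimeComputable

theorem pairWord [Finite α] [Finite β] {f : List α → List β} {g : List α → List Bool}
    (hf : PolyTimeComputable f) (hg : PolyTimeComputable g) :
    PolyTimeComputable fun x => pairWord (f x) (g x) :=
  ((map Sum.inl).comp hf).append ((map Sum.inr).comp hg)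

theorem zipStep [Finite α] [Finite β] {f : List (α ⊕ Bool) → List β}
    (hf : PolyTimeComputable f) :
    ∃ h : List ((Bool ⊕ Option α) ⊕ (Bool ⊕ (Option β ⊕ α))) → List (Bool ⊕ (Option β ⊕ α)),
      PolyTimeComputable h ∧ ∀ a s, h (.inl a :: s.map Sum.inr) = zipStep f a s := by
  have c := PolyTimeDecidable.head
    fun a : Option ((Bool ⊕ Option α) ⊕ (Bool ⊕ (Option β ⊕ α))) =>
      match a with | some (.inl (.inr none)) => true | _ => false
  -- On a letter other than the delimiter, `zipStep` just appends it to the state with a new tag;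
  -- one filter does this for both kinds.
  have hφ : PolyTimeComputable (List.filterMap fun a : Bool ⊕ Option α => match a with
      | .inl b => some (.inl b : Bool ⊕ (Option β ⊕ α))
      | .inr a => a.map fun a => .inr (.inr a)) := filterMap _
  have hd : PolyTimeComputable fun x : List ((Bool ⊕ Option α) ⊕ (Bool ⊕ (Option β ⊕ α))) =>
      _root_.lefts (_root_.rights (_root_.rights x)) := lefts.comp (rights.comp rights)
  have hu : PolyTimeComputable fun x : List ((Bool ⊕ Option α) ⊕ (Bool ⊕ (Option β ⊕ α))) =>
      _root_.rights (_root_.rights (_root_.rights x)) := rights.comp (rights.comp rights)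
  have hc : PolyTimeComputable fun x : List ((Bool ⊕ Option α) ⊕ (Bool ⊕ (Option β ⊕ α))) =>
      _root_.lefts (_root_.rights x) := lefts.comp rights
  have hfirst : PolyTimeComputable firstWord := transduce _ _ _
  have hdrop : PolyTimeComputable dropWord := transduce _ _ _
  refine ⟨_, ite c (((map Sum.inl).comp (hdrop.comp hc)).append ((map Sum.inr).comp ((map Sum.inl).comp
    ((hd.append ((map some).comp (hf.comp (hu.pairWord (hfirst.comp hc))))).append
      (singleton none))))) (rights.append (hφ.comp lefts)), ?_⟩
  rintro (b | _ | a) s <;> simp [_root_.zipStep, zipState]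

theorem zipBlocks [Finite α] [Finite β] {f : List (α ⊕ Bool) → List β}
    (hf : PolyTimeComputable f) : PolyTimeComputable (zipBlocks f) := by
  obtain ⟨r, hr⟩ := hf.length_le
  obtain ⟨h, hh, hH⟩ := hf.zipStep
  have hF := foldl' hh hH (2 * Polynomial.X * (r + 1))
    fun x => by simpa using length_foldl_zipStep f r hr x
  classical
  have c₁ := (PolyTimeDecidable.head fun a : Option (Option α) => decide (a = some none)).comp
    (lefts (β := Bool))
  have c₂ := (PolyTimeDecidable.getLast fun a : Option (Option α) => decide (a = some none)).comp
    (lefts (β := Bool))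
  convert ite c₁ (ite c₂ ((singleton none).append (lefts.comp (rights.comp (hF.comp
    (((map Sum.inl).comp rights).append ((map Sum.inr).comp (tail.comp lefts))))))) nil) nil with v
  simp [_root_.zipBlocks]

end PolyTimeComputable

/-! ### Cutting certificates to the admissible length -/

/-- Truncation of the second component of a pair to the length `p (|x|)`, where `x` is the first
component. -/
def truncPair (p : Polynomial ℕ) (v : List (α ⊕ Bool)) : List (α ⊕ Bool) :=
  pairWord (lefts v) ((rights v).take (p.eval (lefts v).length))

theorem truncPair_pairWord (p : Polynomial ℕ) (x : List α) (y : List Bool) :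
    truncPair p (pairWord x y) = pairWord x (y.take (p.eval x.length)) := by
  rw [truncPair, lefts_pairWord, rights_pairWord]

theorem PolyTimeComputable.truncPair [Finite α] (p : Polynomial ℕ) :
    PolyTimeComputable (truncPair p : List (α ⊕ Bool) → List (α ⊕ Bool)) := by
  have h := lefts.pairWord (((polynomial p).comp (lefts (α := α) (β := Bool))).take rights)
  simp only [List.length_replicate] at h
  exact h

/-! ### Logarithmic space is contained in polynomial time -/

namespace TM

variable {α β : Type} {M : TM α β} {x : List α}

theorem exists_cfgAt_of_le {s t : ℕ} {c : M.Cfg} (h : M.cfgAt x t = some c) (hs : s ≤ t) :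
    ∃ c', M.cfgAt x s = some c' := by
  induction t generalizing c with
  | zero => exact ⟨c, by rwa [Nat.le_zero.1 hs]⟩
  | succ t ih =>
    rcases Nat.lt_or_eq_of_le hs with hs | rfl
    · simp only [cfgAt, Option.bind_eq_some_iff] at h
      obtain ⟨c', h', -⟩ := h
      exact ih h' (by omega)
    · exact ⟨c, h⟩

/-- Equality of configurations up to the output. -/
def Cfg.SameCore (c d : M.Cfg) : Prop :=
  c.state = d.state ∧ c.inPos = d.inPos ∧ c.tape = d.tape ∧ c.head = d.head

theorem Cfg.SameCore.step {c d c' d' : M.Cfg} (h : c.SameCore d) (hc : M.step x c = some c')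
    (hd : M.step x d = some d') : c'.SameCore d' := by
  obtain ⟨h₁, h₂, h₃, h₄⟩ := h
  simp only [TM.step, Option.map_eq_some_iff] at hc hd
  obtain ⟨a, ha, rfl⟩ := hc
  obtain ⟨b, hb, rfl⟩ := hd
  rw [h₁, h₂, h₃, h₄, hb] at ha
  obtain rfl := Option.some.inj ha
  simp [SameCore, h₂, h₃, h₄]

theorem Cfg.SameCore.step_eq_none {c d : M.Cfg} (h : c.SameCore d) (hd : M.step x d = none) :
    M.step x c = none := by
  obtain ⟨h₁, h₂, h₃, h₄⟩ := h
  simp only [TM.step, Option.map_eq_none_iff] at hd ⊢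
  rw [h₁, h₂, h₃, h₄, hd]

/-- A halting computation does not repeat a configuration. -/
theorem not_sameCore_of_halts {i j t : ℕ} {ci cj ct : M.Cfg} (ht : M.cfgAt x t = some ct)
    (hh : M.step x ct = none) (hij : i < j) (hj : j ≤ t) (hci : M.cfgAt x i = some ci)
    (hcj : M.cfgAt x j = some cj) : ¬ ci.SameCore cj := by
  intro h
  obtain ⟨d, rfl⟩ := Nat.exists_eq_add_of_le hj
  induction d generalizing i j ci cj with
  | zero =>
    obtain ⟨c', hc'⟩ := exists_cfgAt_of_le ht (show i + 1 ≤ j + 0 by omega)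
    rw [add_zero, hcj] at ht
    obtain rfl := Option.some.inj ht
    -- Both times have been shifted until the later one is the halting time; the earlier
    -- configuration would then halt too, but it has a successor.
    have := h.step_eq_none hh
    simp [cfgAt, hci, this] at hc'
  | succ d ih =>
    obtain ⟨c', hc'⟩ := exists_cfgAt_of_le ht (show i + 1 ≤ j + (d + 1) by omega)
    obtain ⟨d', hd'⟩ := exists_cfgAt_of_le ht (show j + 1 ≤ j + (d + 1) by omega)
    refine ih (i := i + 1) (j := j + 1) (by omega) hc' hd' ?_
      (by rw [← ht]; congr 1; omega) (by omega)
    simp only [cfgAt, hci, hcj, Option.bind_some] at hc' hd'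
    exact h.step hc' hd'

theorem inPos_le {t : ℕ} {c : M.Cfg} (h : M.cfgAt x t = some c) : c.inPos ≤ x.length + 1 := by
  refine (stepsTo_of_cfgAt_eq_some h).invariant (fun c => c.inPos ≤ x.length + 1) ?_
    (by simp [initCfg])
  intro a b hab ha
  simp only [TM.step, Option.map_eq_some_iff] at hab
  obtain ⟨act, -, rfl⟩ := hab
  rcases act.inMove with _ | _ | _ <;> simp [HeadMove.applyInput] <;> omega

/-- A cell that the head never visits is never written, so the first `s` cells determine the tape
and the configurations can be counted. -/
theorem tape_eq_blank {s t : ℕ} {c : M.Cfg} (hs : M.UsesSpace x s) (h : M.cfgAt x t = some c)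
    (k : M.K) (i : ℕ) (hi : s ≤ i) : c.tape k i = M.blank := by
  induction t generalizing c with
  | zero =>
    obtain rfl : M.initCfg = c := by simpa [cfgAt] using h
    rfl
  | succ t ih =>
    simp only [cfgAt, Option.bind_eq_some_iff] at h
    obtain ⟨d, hd, h⟩ := h
    have hk := hs t d hd k
    simp only [TM.step, Option.map_eq_some_iff] at h
    obtain ⟨act, -, rfl⟩ := h
    simp only
    rw [Function.update_of_ne (by omega)]
    exact ih hd

/-- The number of steps is less than the number of configurations. -/
theorem HaltsWith.lt_of_usesSpace {s t : ℕ} {y : List β} (h : M.HaltsWith x t y)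
    (hs : M.UsesSpace x s) :
    t < Nat.card M.Q * ((x.length + 2) * (((Nat.card M.Γ ^ s) ^ Nat.card M.K) *
      s ^ Nat.card M.K)) := by
  have := M.finQ
  have := M.finK
  have := M.finΓ
  obtain ⟨ct, ht, hh, -⟩ := h
  have hex : ∀ i : Fin (t + 1), ∃ c, M.cfgAt x i = some c := fun i =>
    exists_cfgAt_of_le ht (by omega)
  choose C hC using hex
  -- The output is left out: it grows without bound but does not influence the computation.
  let F : Fin (t + 1) → M.Q × Fin (x.length + 2) × (M.K → Fin s → M.Γ) × (M.K → Fin s) :=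
    fun i => ((C i).state, ⟨(C i).inPos, by have := inPos_le (hC i); omega⟩,
      fun k j => (C i).tape k j, fun k => ⟨(C i).head k, hs _ _ (hC i) k⟩)
  have hF : Function.Injective F := by
    intro i j hij
    have hcore : ∀ i j, F i = F j → (C i).SameCore (C j) := by
      intro i j hij
      simp only [F, Prod.mk.injEq, Fin.mk.injEq] at hij
      obtain ⟨h₁, h₂, h₃, h₄⟩ := hij
      refine ⟨h₁, h₂, ?_, ?_⟩
      · funext k n
        by_cases hn : n < s
        · exact congrFun (congrFun h₃ k) ⟨n, hn⟩
        · rw [tape_eq_blank hs (hC i) k n (by omega), tape_eq_blank hs (hC j) k n (by omega)]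
      · funext k
        simpa using congrFun h₄ k
    rcases lt_trichotomy i j with h | h | h
    · exact absurd (hcore i j hij) (not_sameCore_of_halts ht hh h (by omega) (hC i) (hC j))
    · exact h
    · exact absurd (hcore j i hij.symm) (not_sameCore_of_halts ht hh h (by omega) (hC j) (hC i))
  have := Nat.card_le_card_of_injective F hF
  simp only [Nat.card_prod, Nat.card_fun, Nat.card_eq_fintype_card, Fintype.card_fin] at this ⊢
  omega

end TM

/-- The same machine works. The number of tape contents is polynomial since, with `L = log n + 1`,
`|Γ| ^ (c * L) ≤ (2 ^ L) ^ (|Γ| * c)` and `2 ^ L ≤ 2 * (n + 1)`. -/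
theorem LogSpaceComputable.polyTimeComputable {α β : Type} {f : List α → List β}
    (h : LogSpaceComputable f) : PolyTimeComputable f := by
  obtain ⟨M, c, h⟩ := h
  refine ⟨M, .C (Nat.card M.Q) * ((.X + 2) * ((((2 * (.X + 1)) ^ (Nat.card M.Γ * c)) ^
    Nat.card M.K) * (.C c * (.X + 1)) ^ Nat.card M.K)), fun x => ?_⟩
  obtain ⟨⟨t, ht⟩, hs⟩ := h x
  refine ⟨t, (ht.lt_of_usesSpace hs).le.trans ?_, ht⟩
  have hlog : 2 ^ (Nat.log 2 x.length + 1) ≤ 2 * (x.length + 1) := by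
    rcases eq_or_ne x.length 0 with h | h
    · simp [h]
    · have := Nat.pow_log_le_self 2 h
      rw [pow_succ]
      omega
  have h₁ : Nat.card M.Γ ^ (c * (Nat.log 2 x.length + 1)) ≤
      (2 * (x.length + 1)) ^ (Nat.card M.Γ * c) :=
    calc _ ≤ (2 ^ Nat.card M.Γ) ^ (c * (Nat.log 2 x.length + 1)) :=
          Nat.pow_le_pow_left Nat.lt_two_pow_self.le _
      _ = (2 ^ (Nat.log 2 x.length + 1)) ^ (Nat.card M.Γ * c) := by
          rw [← pow_mul, ← pow_mul]
          congr 1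
          ring
      _ ≤ _ := Nat.pow_le_pow_left hlog _
  have h₂ : c * (Nat.log 2 x.length + 1) ≤ c * (x.length + 1) :=
    Nat.mul_le_mul_left _ (by have := Nat.log_le_self 2 x.length; omega)
  simp only [Polynomial.eval_mul, Polynomial.eval_C, Polynomial.eval_add, Polynomial.eval_X,
    Polynomial.eval_pow, Polynomial.eval_one, Polynomial.eval_ofNat]
  gcongr

/-! ### The classes of the polynomial hierarchy are normal -/

section

variable {α β : Type}

/-- The preimage of a language under a function on words. -/
def wordPreimage (f : List α → List β) (L : Language β) : Language α := {x | f x ∈ L}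

theorem mem_wordPreimage {f : List α → List β} {L : Language β} {x : List α} :
    x ∈ wordPreimage f L ↔ f x ∈ L := Iff.rfl

theorem wordPreimage_compl (f : List α → List β) (L : Language β) :
    (wordPreimage f L)ᶜ = wordPreimage f Lᶜ := rfl

theorem notMem_compl_iff {L : Language α} {x : List α} : x ∉ Lᶜ ↔ x ∈ L := not_not

/-! ### The base level P -/

theorem ClassP.preimage [Finite α] [Finite β] {L : Language β} {f : List α → List β} (hL : ClassP β L)
    (hf : PolyTimeComputable f) : ClassP α (wordPreimage f L) :=
  PolyTimeComputable.comp hL hf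

theorem ClassP.compl [Finite α] {L : Language α} (hL : ClassP α L) : ClassP α Lᶜ := by
  unfold ClassP at hL ⊢
  convert (PolyTimeComputable.map not).comp hL with x
  by_cases h : x ∈ L
  · simpa [h] using fun h' : x ∈ Lᶜ => h' h
  · simpa [h] using (show x ∈ Lᶜ from h)

theorem zipWords_const (f : List α → List β) (l : List (List α)) (y : List Bool) :
    zipWords (fun v => f (lefts v)) l y = l.map f := by
  induction l generalizing y with
  | nil => rfl
  | cons x l ih => simp [zipWords, ih, lefts_pairWord]

theorem some_mem_listWord {a : α} {l : List (List α)} :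
    some a ∈ listWord l ↔ ∃ x ∈ l, a ∈ x := by
  simp [listWord]

theorem PolyTimeDecidable.mem (a : α) : PolyTimeDecidable fun x : List α => a ∈ x := by
  classical
  have key : ∀ (x : List α) (b : Bool), transduce (fun q c => (q || decide (c = a), none))
      (fun q => some q) b x = [b || decide (a ∈ x)] := by
    intro x
    induction x with
    | nil => intro b; simp [transduce]
    | cons c x ih =>
      intro b
      simp only [transduce, Option.toList, List.nil_append, ih, Bool.or_assoc, List.mem_cons]
      by_cases h : c = a
      · simp [h]
      · simp [h, Ne.symm h]
  unfold PolyTimeDecidable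
  convert PolyTimeComputable.transduce (fun (q : Bool) c => (q || decide (c = a), none))
    (fun q => some q) false with x
  rw [key]
  simp

/-- Each block is replaced by the one-letter word that tells whether it is in `X`; it remains to
search for the letter `some true`. The certificates are empty and ignored. -/
theorem ClassP.seqLang [Finite α] {X : Language α} (hX : ClassP α X) : ClassP (Option α) (SeqLang X) := by
  classical
  have h : PolyTimeComputable fun v : List (α ⊕ Bool) => [decide (lefts v ∈ X)] :=
    PolyTimeComputable.comp hX .lefts
  show PolyTimeDecidable fun w => w ∈ SeqLang X
  have h' := (PolyTimeDecidable.mem (some true)).comp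
    (h.zipBlocks.comp (PolyTimeComputable.id'.pairWord (.nil (α := Option α))))
  convert h' using 2 with w
  by_cases hw : ∃ l, w = listWord l
  · obtain ⟨l, rfl⟩ := hw
    rw [zipBlocks_listWord, zipWords_const (fun x => [decide (x ∈ X)]), mem_SeqLang_listWord,
      some_mem_listWord]
    simp
  · rw [zipBlocks_of_not_listWord _ _ _ hw]
    simp only [List.not_mem_nil, iff_false]
    exact fun ⟨l, h, _⟩ => hw ⟨l, h⟩

/-! ### Certificates for all blocks at once -/

/-- Soundness for the existential case: by truncation, each pair formed carries an admissible
certificate even if `y` is arbitrary. -/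
theorem zipWords_truncPair_of_mem {p : Polynomial ℕ} {l : List (List α)} {y : List Bool}
    {z : List (α ⊕ Bool)} (h : z ∈ zipWords (truncPair p) l y) :
    ∃ x ∈ l, ∃ y', y'.length ≤ p.eval x.length ∧ z = pairWord x y' := by
  induction l generalizing y with
  | nil => simp [zipWords] at h
  | cons x l ih =>
    rcases List.mem_cons.1 h with rfl | h
    · exact ⟨x, by simp, (firstWord y).take (p.eval x.length), by simp,
        truncPair_pairWord _ _ _⟩
    · obtain ⟨x', hx', h⟩ := ih h
      exact ⟨x', by simp [hx'], h⟩

/-- Soundness for the universal case: no block is skipped, even if `y` is too short or malformed,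
because the decoders are total. -/
theorem exists_mem_zipWords_truncPair {p : Polynomial ℕ} {l : List (List α)} {y : List Bool}
    {x : List α} (h : x ∈ l) :
    ∃ y', y'.length ≤ p.eval x.length ∧ pairWord x y' ∈ zipWords (truncPair p) l y := by
  induction l generalizing y with
  | nil => simp at h
  | cons x' l ih =>
    rcases List.mem_cons.1 h with rfl | h
    · refine ⟨(firstWord y).take (p.eval x.length), by simp, ?_⟩
      simp [zipWords, truncPair_pairWord]
    · obtain ⟨y', hy', h⟩ := ih (y := dropWord y) h
      exact ⟨y', hy', by simp [zipWords, h]⟩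

/-- Completeness: the codes of the certificates are concatenated. In a word of length `n` there are
at most `n` blocks, each of length at most `n`, and a code has length at most `2 * p n + 1`. -/
theorem exists_zipWords_truncPair (p : Polynomial ℕ) (Y : List α → List Bool)
    (hY : ∀ x, (Y x).length ≤ p.eval x.length) (l : List (List α)) :
    ∃ y : List Bool, y.length ≤ (.X * (2 * p + 1) : Polynomial ℕ).eval (listWord l).length ∧
      zipWords (truncPair p) l y = l.map fun x => pairWord x (Y x) := by
  refine ⟨l.flatMap fun x => encodeWord (Y x), ?_, ?_⟩
  · have h : ∀ x ∈ l, (encodeWord (Y x)).length ≤ 2 * p.eval (listWord l).length + 1 := by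
      intro x hx
      have := (hY x).trans (p.eval_mono_nat (length_le_of_mem hx))
      simp only at this
      rw [length_encodeWord]
      omega
    rw [List.length_flatMap]
    refine (List.sum_le_card_nsmul _ (2 * p.eval (listWord l).length + 1) ?_).trans ?_
    · intro n hn
      obtain ⟨x, hx, rfl⟩ := List.mem_map.1 hn
      exact h x hx
    · simp only [List.length_map, smul_eq_mul, Polynomial.eval_mul, Polynomial.eval_X,
        Polynomial.eval_add, Polynomial.eval_ofNat, Polynomial.eval_one]
      exact Nat.mul_le_mul_right _ (length_le_length_listWord l)
  · induction l with
    | nil => rfl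
    | cons x l ih =>
      simp only [List.flatMap_cons, zipWords, firstWord_encodeWord, dropWord_encodeWord, ih,
        truncPair_pairWord, List.take_of_length_le (hY x), List.map_cons]

end

/-- A certificate for `f x` serves for `x`. Its bound becomes `p (r |x|)`, which may exceed `p |f
x|`; the new verifier therefore truncates the certificate to the original bound before it consults
`V`. -/
theorem SigmaP.preimage (k : ℕ) {α β : Type} [Finite α] [Finite β] {L : Language β}
    {f : List α → List β} (hL : SigmaP k β L) (hf : PolyTimeComputable f) :
    SigmaP k α (wordPreimage f L) := by
  induction k generalizing α β with
  | zero => exact ClassP.preimage hL hf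
  | succ k ih =>
    obtain ⟨V, p, hV, hL⟩ := hL
    obtain ⟨r, hr⟩ := hf.length_le
    have hg : PolyTimeComputable fun v : List (α ⊕ Bool) =>
        truncPair p (pairWord (f (lefts v)) (rights v)) :=
      (PolyTimeComputable.truncPair p).comp
        (PolyTimeComputable.pairWord (hf.comp .lefts) .rights)
    refine ⟨wordPreimage (fun v => truncPair p (pairWord (f (lefts v)) (rights v))) V, p.comp r,
      wordPreimage_compl _ V ▸ ih hV hg, fun x => ?_⟩
    have hmem : ∀ y, pairWord x y ∈
        wordPreimage (fun v => truncPair p (pairWord (f (lefts v)) (rights v))) V ↔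
          pairWord (f x) (y.take (p.eval (f x).length)) ∈ V := by
      intro y
      rw [mem_wordPreimage, lefts_pairWord, rights_pairWord, truncPair_pairWord]
    constructor
    · intro hx
      obtain ⟨y, hy, hyV⟩ := (hL (f x)).1 hx
      refine ⟨y, hy.trans ?_, (hmem y).2 ?_⟩
      · rw [Polynomial.eval_comp]
        exact p.eval_mono_nat (hr x)
      · rwa [List.take_of_length_le hy]
    · rintro ⟨y, -, hyV⟩
      exact (hL (f x)).2 ⟨_, by simp, (hmem y).1 hyV⟩

/-- Both halves are proved together because the verifier at level `k + 1` is given through its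
complement at level `k`: the first half uses the second for `V`, the second half uses the first for
`Vᶜ`. -/
theorem SigmaP.seqLang (k : ℕ) {α : Type} [Finite α] (X : Language α) :
    (SigmaP k α X → SigmaP k (Option α) (SeqLang X)) ∧
      (SigmaP k α Xᶜ → SigmaP k (Option α) (SeqLang X)ᶜ) := by
  classical
  induction k generalizing α with
  | zero =>
    refine ⟨ClassP.seqLang, fun h => (ClassP.seqLang ?_).compl⟩
    have := ClassP.compl h
    rwa [compl_compl] at this
  | succ k ih =>
    have hg : ∀ p : Polynomial ℕ, PolyTimeComputable
        (zipBlocks (truncPair p : List (α ⊕ Bool) → List (α ⊕ Bool))) :=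
      fun p => (PolyTimeComputable.truncPair p).zipBlocks
    have hY : ∀ {L : Language α} {V : Language (α ⊕ Bool)} {p : Polynomial ℕ},
        (∀ x, x ∈ L ↔ ∃ y : List Bool, y.length ≤ p.eval x.length ∧ pairWord x y ∈ V) →
        ∃ Y : List α → List Bool, (∀ x, (Y x).length ≤ p.eval x.length) ∧
          ∀ x ∈ L, pairWord x (Y x) ∈ V := by
      intro L V p hL
      have : ∀ x, ∃ y : List Bool, y.length ≤ p.eval x.length ∧ (x ∈ L → pairWord x y ∈ V) := by
        intro x
        by_cases hx : x ∈ L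
        · obtain ⟨y, hy, h⟩ := (hL x).1 hx
          exact ⟨y, hy, fun _ => h⟩
        -- A dummy certificate, so that every block of the list can be given one.
        · exact ⟨[], by simp, fun h => absurd h hx⟩
      choose Y h₁ h₂ using this
      exact ⟨Y, h₁, h₂⟩
    constructor
    · rintro ⟨V, p, hV, hL⟩
      obtain ⟨Y, hY₁, hY₂⟩ := hY hL
      refine ⟨wordPreimage (zipBlocks (truncPair p)) (SeqLang V), .X * (2 * p + 1),
        wordPreimage_compl _ (SeqLang V) ▸ SigmaP.preimage k ((ih V).2 hV) (hg p), fun w => ?_⟩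
      by_cases hw : ∃ l, w = listWord l
      · obtain ⟨l, rfl⟩ := hw
        have hmem : ∀ y, pairWord (listWord l) y ∈
            wordPreimage (zipBlocks (truncPair p)) (SeqLang V) ↔ ∃ z ∈ zipWords (truncPair p) l y, z ∈ V := by
          intro y
          rw [mem_wordPreimage, zipBlocks_listWord, mem_SeqLang_listWord]
        rw [mem_SeqLang_listWord]
        constructor
        · rintro ⟨x, hx, hxX⟩
          obtain ⟨y, hy, hz⟩ := exists_zipWords_truncPair p Y hY₁ l
          refine ⟨y, hy, (hmem y).2 ?_⟩
          rw [hz]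
          exact ⟨_, List.mem_map_of_mem hx, hY₂ x hxX⟩
        · rintro ⟨y, -, h⟩
          obtain ⟨z, hz, hzV⟩ := (hmem y).1 h
          obtain ⟨x, hx, y', hy', rfl⟩ := zipWords_truncPair_of_mem hz
          exact ⟨x, hx, (hL x).2 ⟨y', hy', hzV⟩⟩
      · refine iff_of_false (fun ⟨l, h, _⟩ => hw ⟨l, h⟩) ?_
        rintro ⟨y, -, h⟩
        rw [mem_wordPreimage, zipBlocks_of_not_listWord _ _ _ hw] at h
        exact nil_notMem_SeqLang h
    · rintro ⟨V, p, hV, hL⟩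
      obtain ⟨Y, hY₁, hY₂⟩ := hY hL
      refine ⟨wordPreimage (zipBlocks (truncPair p)) (SeqLang Vᶜ)ᶜ, .X * (2 * p + 1), ?_,
        fun w => ?_⟩
      · rw [wordPreimage_compl, compl_compl]
        exact SigmaP.preimage k ((ih Vᶜ).1 hV) (hg p)
      by_cases hw : ∃ l, w = listWord l
      · obtain ⟨l, rfl⟩ := hw
        have hmem : ∀ y, pairWord (listWord l) y ∈
            wordPreimage (zipBlocks (truncPair p)) (SeqLang Vᶜ)ᶜ ↔ ∀ z ∈ zipWords (truncPair p) l y, z ∈ V := by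
          intro y
          rw [mem_wordPreimage, zipBlocks_listWord]
          refine (not_congr mem_SeqLang_listWord).trans ?_
          push Not
          exact forall₂_congr fun z _ => notMem_compl_iff
        have hl : listWord l ∈ (SeqLang X)ᶜ ↔ ∀ x ∈ l, x ∈ Xᶜ := by
          refine (not_congr mem_SeqLang_listWord).trans ?_
          push Not
          rfl
        rw [hl]
        constructor
        · intro h
          obtain ⟨y, hy, hz⟩ := exists_zipWords_truncPair p Y hY₁ l
          refine ⟨y, hy, (hmem y).2 ?_⟩
          rw [hz]
          intro z hz
          obtain ⟨x, hx, rfl⟩ := List.mem_map.1 hz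
          exact hY₂ x (h x hx)
        · rintro ⟨y, -, h⟩ x hx
          obtain ⟨y', hy', hz⟩ := exists_mem_zipWords_truncPair (p := p) (y := y) hx
          exact (hL x).2 ⟨y', hy', (hmem y).1 h _ hz⟩
      -- Malformed words belong to the complement of Seq and must be accepted; any certificate, such
      -- as the empty one, does it.
      · refine iff_of_true (fun ⟨l, h, _⟩ => hw ⟨l, h⟩) ⟨[], by simp, fun h => ?_⟩
        rw [zipBlocks_of_not_listWord _ _ _ hw] at h
        exact nil_notMem_SeqLang h

theorem LogSpaceReducible.sigmaP (k : ℕ) {α β : Type} [Finite α] [Finite β] {X : Language α}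
    {Y : Language β} (hX : SigmaP k α X) (h : LogSpaceReducible Y X) : SigmaP k β Y := by
  obtain ⟨f, hf, h⟩ := h
  have : Y = wordPreimage f X := Set.ext h
  rw [this]
  exact SigmaP.preimage k hX hf.polyTimeComputable

theorem mainTheorem6 : ∀ k : ℕ, IsNormalClass (SigmaP k) ∧ IsNormalClass (PiP k) := by
  refine fun k => ⟨⟨fun α _ X => (SigmaP.seqLang k X).1, fun α β _ _ X Y hX h => h.sigmaP k hX⟩,
    fun α _ X => (SigmaP.seqLang k X).2, fun α β _ _ X Y hX h => ?_⟩
  -- The same `f` reduces the complement of `Y` to that of `X`.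
  obtain ⟨f, hf, h⟩ := h
  exact LogSpaceReducible.sigmaP k hX ⟨f, hf, fun x => not_congr (h x)⟩
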